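/- **Circuits.** A circuit over Boolean variables $\mathbf X=\{X_v\}_{v\in V}$ is a finite acyclic graph of units with one output unit. An input unit $n$ has a scope $\mathrm{sc}(n)\subseteq\mathbf X$ and computes a real function of the variables in its scope. A product unit computes the product of its (at least one) input units. A sum unit computes a linear combination $\sum_i w_i c_i$ of its (at least one) input units $c_i$ with real weights $w_i$. The scope of a product or sum unit is the union of the scopes of its inputs. A circuit computes $F(\mathbf X)$ if its output unit has scope $\mathbf X$ and computes $F$. Its size is its number of edges. A circuit is *structured-decomposable* if the inputs of each sum unit all have the same scope, distinct inputs of each product unit have disjoint scopes, and any two product units with the same scope partition it into the (non-empty) scopes of their inputs in the same way. It is *monotonic* if all its weights and all its input functions are non-negative. A *shallow mixture* is a circuit with output scope $\mathbf X$ whose output is a sum unit $\sum_i w_i c_i$ with arbitrary real weights, each component $c_i$ being a product of input units of one variable each. Its *square* is the shallow mixture $\sum_{i,j} w_iw_j\,(c_ic_j)$, with one component computing $c_ic_j$ for each pair $(i,j)$. **Theorem.** There are $d\in\mathbb N$, $\varepsilon>0$ and a family $(G_n)_{n\in\mathbb N}$ of finite graphs $G_n=(V_n,E_n)$ with $|V_n|\ge\max(n,2)$,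 of maximum degree at most $d$, and with expansion $\varepsilon$ (every $S\subseteq V_n$ with $|S|\le|V_n|/2$ has at least $\varepsilon|S|$ edges to $V_n\setminus S$), such that the non-negative functions $$\mathsf{UDISJ}_{G_n}(\mathbf X)=\Bigl(1-\sum_{uv\in E_n}X_uX_v\Bigr)^2,\qquad \mathbf X=\{X_v\}_{v\in V_n}\ \text{Boolean},$$ have the following two properties. 1. There is a polynomial $p$ such that for every $n$ there are a structured-decomposable shallow mixture $c$ of size at most $p(|V_n|)$ and a structured-decomposable square $c^2$ of $c$ of size at most $p(|V_n|)$ that computes $\mathsf{UDISJ}_{G_n}$. 2. There is $\alpha>0$ such that for every $n$, every structured-decomposable monotonic circuit that computes $\mathsf{UDISJ}_{G_n}$ and whose input units each have a scope of at most $\tfrac23|V_n|$ variables (for example one variable each) has size at least $2^{\alpha|V_n|}$. -/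

import Mathlib

/-- The kind of a computational unit of a circuit over Boolean variables indexed by `V`, whose units
are indexed by `U`: an input unit has a scope `Y` and an arbitrary real function of the variables in
`Y`; a sum unit carries real weights `w i`, one for each of its inputs `i`. -/
inductive UnitKind (V U : Type) : Type where
  | input (Y : Finset V) (f : (Y → Bool) → ℝ)
  | product
  | sum (w : U → ℝ)

/-- A circuit over Boolean variables indexed by `V`: a finite acyclic computational graph of input,
product and sum units, with a designated output unit. Exactly the product and sum units receive
inputs from other units. -/
structure Circuit (V : Type) where
  U : Type
  [fintypeU : Fintype U]
  [decEqU : DecidableEq U]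
  kind : U → UnitKind V U
  inputs : U → Finset U
  acyclic : WellFounded (fun i n : U => i ∈ inputs n)
  inputs_eq_empty_iff : ∀ n, inputs n = ∅ ↔ ∃ Y f, kind n = UnitKind.input Y f
  output : U

attribute [instance] Circuit.fintypeU Circuit.decEqU

namespace Circuit

variable {V : Type}

/-- The value computed by each unit on the assignment `x`. -/
noncomputable def value (c : Circuit V) (x : V → Bool) : c.U → ℝ :=
  c.acyclic.fix fun n ih =>
    match c.kind n with
    | .input Y f => f (fun v : Y => x v)
    | .product => ∏ i ∈ (c.inputs n).attach, ih i.1 i.2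
    | .sum w => ∑ i ∈ (c.inputs n).attach, w i.1 * ih i.1 i.2

/-- The scope of each unit: given for an input unit, the union of the scopes of the inputs for a
product or sum unit. -/
noncomputable def scope [DecidableEq V] (c : Circuit V) : c.U → Finset V :=
  c.acyclic.fix fun n ih =>
    match c.kind n with
    | .input Y _ => Y
    | _ => (c.inputs n).attach.biUnion fun i => ih i.1 i.2

theorem value_input {c : Circuit V} {x : V → Bool} {n : c.U} {Y : Finset V}
    {f : (Y → Bool) → ℝ} (h : c.kind n = .input Y f) :
    c.value x n = f (fun v : Y => x v) := by
  rw [value, WellFounded.fix_eq, h]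

theorem value_product {c : Circuit V} {x : V → Bool} {n : c.U} (h : c.kind n = .product) :
    c.value x n = ∏ i ∈ c.inputs n, c.value x i := by
  rw [value, WellFounded.fix_eq, h]
  exact Finset.prod_attach (c.inputs n) (fun i => c.value x i)

theorem value_sum {c : Circuit V} {x : V → Bool} {n : c.U} {w : c.U → ℝ}
    (h : c.kind n = .sum w) :
    c.value x n = ∑ i ∈ c.inputs n, w i * c.value x i := by
  rw [value, WellFounded.fix_eq, h]
  exact Finset.sum_attach (c.inputs n) (fun i => w i * c.value x i)

theorem scope_input [DecidableEq V] {c : Circuit V} {n : c.U} {Y : Finset V}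
    {f : (Y → Bool) → ℝ} (h : c.kind n = .input Y f) : c.scope n = Y := by
  rw [scope, WellFounded.fix_eq, h]

theorem scope_product [DecidableEq V] {c : Circuit V} {n : c.U} (h : c.kind n = .product) :
    c.scope n = (c.inputs n).biUnion c.scope := by
  rw [scope, WellFounded.fix_eq, h]
  ext v
  simp

theorem scope_sum [DecidableEq V] {c : Circuit V} {n : c.U} {w : c.U → ℝ}
    (h : c.kind n = .sum w) : c.scope n = (c.inputs n).biUnion c.scope := by
  rw [scope, WellFounded.fix_eq, h]
  ext v
  simp

/-- The size of a circuit: the number of edges of its computational graph. -/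
def size (c : Circuit V) : ℕ := ∑ n : c.U, (c.inputs n).card

/-- `c` is a circuit over all the variables that computes the function `F`. -/
def Computes [Fintype V] [DecidableEq V] (c : Circuit V) (F : (V → Bool) → ℝ) : Prop :=
  c.scope c.output = Finset.univ ∧ ∀ x, c.value x c.output = F x

/-- All inputs of a sum unit have the same scope. -/
def IsSmooth [DecidableEq V] (c : Circuit V) : Prop :=
  ∀ n w, c.kind n = .sum w → ∀ i ∈ c.inputs n, ∀ j ∈ c.inputs n, c.scope i = c.scope j

/-- Distinct inputs of a product unit have disjoint scopes. -/
def IsDecomposable [DecidableEq V] (c : Circuit V) : Prop :=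
  ∀ n, c.kind n = .product →
    ∀ i ∈ c.inputs n, ∀ j ∈ c.inputs n, i ≠ j → Disjoint (c.scope i) (c.scope j)

/-- The partition of the scope of a (decomposable) product unit into the scopes of its inputs. -/
noncomputable def partition [DecidableEq V] (c : Circuit V) (n : c.U) : Finset (Finset V) :=
  ((c.inputs n).image c.scope).erase ∅

/-- Smooth, decomposable, and any two product units with the same scope partition it in the same
way. -/
def IsStructuredDecomposable [DecidableEq V] (c : Circuit V) : Prop :=
  c.IsSmooth ∧ c.IsDecomposable ∧
    ∀ n m, c.kind n = .product → c.kind m = .product → c.scope n = c.scope m →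
      c.partition n = c.partition m

/-- All weights of sum units and all input functions are non-negative. -/
def IsMonotonic (c : Circuit V) : Prop :=
  (∀ n w, c.kind n = .sum w → ∀ i ∈ c.inputs n, 0 ≤ w i) ∧
    ∀ n Y f, c.kind n = .input Y f → ∀ y, 0 ≤ f y

/-- A shallow mixture over all the variables, with real (possibly negative) weights: the output is a
sum unit, and each of its inputs (the components of the mixture) is a product of input units that
depend on a single variable each. -/
def IsShallowMixture [Fintype V] [DecidableEq V] (c : Circuit V) : Prop :=
  c.scope c.output = Finset.univ ∧
    (∃ w, c.kind c.output = .sum w) ∧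
    ∀ i ∈ c.inputs c.output, c.kind i = .product ∧
      ∀ j ∈ c.inputs i, ∃ Y f, c.kind j = .input Y f ∧ Y.card = 1

/-- `q` is the square of the mixture `c = ∑ i, w i * c i`, expanded as the mixture
`∑ i, ∑ j, (w i * w j) * (c i * c j)`: its components are indexed by the pairs of components of `c`,
compute the products `c i * c j`, and have the weights `w i * w j`. -/
def IsSquareOf (q c : Circuit V) : Prop :=
  ∃ w w', c.kind c.output = .sum w ∧ q.kind q.output = .sum w' ∧
    ∃ e : (c.inputs c.output × c.inputs c.output) ≃ q.inputs q.output,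
      ∀ i j, w' (e (i, j)) = w i * w j ∧
        ∀ x, q.value x (e (i, j)) = c.value x i * c.value x j

end Circuit

open Classical in
/-- The unique disjointness function `(1 - ∑_{uv ∈ E} X_u X_v) ^ 2` of the graph `G`. -/
noncomputable def udisj {V : Type} [Fintype V] (G : SimpleGraph V) (x : V → Bool) : ℝ :=
  (1 - ∑ e ∈ G.edgeFinset, (e.map fun v => if x v then (1 : ℝ) else 0).mul) ^ 2

open Classical in
/-- `G` has expansion `ε`: every set `S` of at most half of the vertices has at least `ε * |S|`
edges to its complement. -/
def HasExpansion {V : Type} [Fintype V] (G : SimpleGraph V) (ε : ℝ) : Prop :=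
  ∀ S : Finset V, 2 * S.card ≤ Fintype.card V → ε * S.card ≤ ((G.interedges S Sᶜ).card : ℝ)

open Classical in
/-- Every vertex of `G` has degree at most `d`. -/
def DegreeAtMost {V : Type} [Fintype V] (G : SimpleGraph V) (d : ℕ) : Prop :=
  ∀ v, G.degree v ≤ d

/-! Upper bound: before squaring, the function is a linear combination of the constant 1 and one
monomial per edge. This is a shallow mixture with polynomially many components; a component of its
square is again a product of univariate functions (`Circuit.exists_square_udisj`).

Lower bound: in a structured-decomposable circuit all product units of a given scope split it in the
same way. Descending from the output to the smallest scope of more than two thirds of the variables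
through which the output factors, and grouping its parts, gives one balanced cut `Y` for which the
computed function is a sum of at most `size` products of a function on `Y` and a function off `Y`,
all non-negative by monotonicity (`Circuit.exists_balanced_factorization`).

In a bounded-degree expander many edges cross this cut, and a linear number of them form an induced
matching `M` (`exists_induced_matching`). Setting the left endpoints of `a ⊆ M` and the right
endpoints of `b ⊆ M` makes the function equal to `(1 - #(a ∩ b)) ^ 2` (`udisj_matchingAssignment`),
a unique disjointness matrix. The support of each term is a rectangle without pairs meeting exactly
once, so it contains at most `2 ^ #M` of the `3 ^ #M` disjoint pairs (`card_disjoint_pairs_le`);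
hence at least `(3 / 2) ^ #M` terms are needed.

The expanders are Margulis graphs on `(ZMod m)²`. Their spectral gap (`margulis_poincare`) is proved
by Fourier analysis: translations become multiplications by characters and shears become shears. -/

/-! ### Rectangle bound for unique disjointness -/

open Finset in
/-- A combinatorial rectangle of pairs of subsets of `s` without pairs that meet in exactly one
element contains at most `2 ^ #s` disjoint pairs. -/
theorem card_disjoint_pairs_le {ι : Type*} [DecidableEq ι] (s : Finset ι)
    (A B : Finset (Finset ι))
    (h : ∀ a ∈ A, ∀ b ∈ B, (a ∩ b).card ≠ 1) :
    ((s.powerset ×ˢ s.powerset).filter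
      fun p => p.1 ∈ A ∧ p.2 ∈ B ∧ Disjoint p.1 p.2).card ≤ 2 ^ s.card := by
  induction s using Finset.induction_on generalizing A B with
  | empty =>
    refine (card_filter_le _ _).trans ?_
    simp
  | insert i s hi ih =>
    set P := s.powerset with hP
    -- Sections of the rectangle according to membership of `i`. The smaller rectangles `(A0 ∪ A') ×
    -- B0` and `A0 × (B0 ∪ B')` inherit the hypothesis, because `i` lies in at most one of the two
    -- sets and so does not affect their intersection.
    set A' := P.filter fun a => insert i a ∈ A with hA'
    set B' := P.filter fun b => insert i b ∈ B with hB'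
    set A0 := P.filter fun a => a ∈ A with hA0
    set B0 := P.filter fun b => b ∈ B with hB0
    have hni : ∀ a ∈ P, i ∉ a := fun a ha hia => hi (mem_powerset.1 ha hia)
    have h1 := ih (A0 ∪ A') B0 (by
      intro a ha b hb
      have hb' := mem_filter.1 hb
      rcases mem_union.1 ha with ha | ha
      · exact h a (mem_filter.1 ha).2 b hb'.2
      · have := h _ (mem_filter.1 ha).2 b hb'.2
        rwa [insert_inter_of_notMem (hni b hb'.1)] at this)
    have h2 := ih A0 (B0 ∪ B') (by
      intro a ha b hb
      have ha' := mem_filter.1 ha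
      rcases mem_union.1 hb with hb | hb
      · exact h a ha'.2 b (mem_filter.1 hb).2
      · have := h a ha'.2 _ (mem_filter.1 hb).2
        rwa [inter_insert_of_notMem (hni a ha'.1)] at this)
    rw [card_insert_of_notMem hi, pow_succ, mul_two]
    refine le_trans ?_ (add_le_add h1 h2)
    simp only [card_filter]
    rw [sum_product, sum_product, sum_product, ← sum_add_distrib]
    simp only [← sum_add_distrib]
    rw [sum_powerset_insert hi, ← sum_add_distrib]
    refine sum_le_sum fun a ha => ?_
    rw [sum_powerset_insert hi, sum_powerset_insert hi, ← sum_add_distrib, ← sum_add_distrib,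
      ← sum_add_distrib]
    refine sum_le_sum fun b hb => ?_
    have ha' := hni a ha
    have hb' := hni b hb
    have hd1 : Disjoint (insert i a) b ↔ Disjoint a b := by simp [disjoint_insert_left, hb']
    have hd2 : Disjoint a (insert i b) ↔ Disjoint a b := by simp [disjoint_insert_right, ha']
    have hd3 : ¬ Disjoint (insert i a) (insert i b) := by simp [disjoint_insert_left]
    -- Both extensions at once would meet in `{i}` only. This is what lets the two smaller
    -- rectangles absorb all disjoint extensions of `(a, b)`.
    have hx : Disjoint a b → insert i a ∈ A → insert i b ∈ B → False := by
      intro hab hA hB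
      apply h _ hA _ hB
      rw [← insert_inter_distrib, disjoint_iff_inter_eq_empty.1 hab]
      simp
    simp only [hd1, hd2, hd3, mem_union, hA0, hB0, hA', hB', mem_filter, and_false, if_false]
    by_cases hab : Disjoint a b
    · have := hx hab
      by_cases p1 : a ∈ A <;> by_cases p2 : b ∈ B <;> by_cases p3 : insert i a ∈ A <;>
        by_cases p4 : insert i b ∈ B <;> simp_all
    · simp [hab]

-- Each element has three choices: in the first set only, in the second only, or in neither.
open Finset in
theorem card_disjoint_pairs {ι : Type*} [DecidableEq ι] (s : Finset ι) :
    ((s.powerset ×ˢ s.powerset).filter fun p => Disjoint p.1 p.2).card = 3 ^ s.card := by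
  induction s using Finset.induction_on with
  | empty => simp [filter_singleton]
  | insert i s hi ih =>
    rw [card_insert_of_notMem hi, pow_succ, ← ih]
    simp only [card_filter]
    rw [sum_product, sum_product, sum_powerset_insert hi, ← sum_add_distrib, sum_mul]
    refine sum_congr rfl fun a ha => ?_
    rw [sum_powerset_insert hi, sum_powerset_insert hi, ← sum_add_distrib, ← sum_add_distrib,
      ← sum_add_distrib, sum_mul]
    refine sum_congr rfl fun b hb => ?_
    have ha' : i ∉ a := fun hia => hi (mem_powerset.1 ha hia)
    have hb' : i ∉ b := fun hia => hi (mem_powerset.1 hb hia)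
    simp only [disjoint_insert_left, disjoint_insert_right, ha', hb', mem_insert, true_or,
      not_true, not_false_iff, true_and, false_and, if_false]
    split_ifs <;> rfl

open Finset in
/-- A non-negative factorization of a unique disjointness matrix has at least `(3 / 2) ^ #s`
terms. -/
theorem three_pow_le_of_factorization {ι κ : Type*} [DecidableEq ι] (s : Finset ι) (K : Finset κ)
    (f g : κ → Finset ι → ℝ) (hf : ∀ k ∈ K, ∀ a, 0 ≤ f k a) (hg : ∀ k ∈ K, ∀ a, 0 ≤ g k a)
    (h0 : ∀ a ⊆ s, ∀ b ⊆ s, Disjoint a b → ∑ k ∈ K, f k a * g k b ≠ 0)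
    (h1 : ∀ a ⊆ s, ∀ b ⊆ s, (a ∩ b).card = 1 → ∑ k ∈ K, f k a * g k b = 0) :
    3 ^ s.card ≤ K.card * 2 ^ s.card := by
  classical
  rw [← card_disjoint_pairs]
  -- The disjoint pairs in the support of the `k`-th term. Since the terms are non-negative and
  -- cannot cancel, the support contains no pair that meets exactly once.
  let R : κ → Finset (Finset ι × Finset ι) := fun k =>
    (s.powerset ×ˢ s.powerset).filter fun p =>
      p.1 ∈ s.powerset.filter (fun a => f k a ≠ 0) ∧
      p.2 ∈ s.powerset.filter (fun b => g k b ≠ 0) ∧ Disjoint p.1 p.2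
  refine le_trans (card_le_card (t := K.biUnion R) ?_) (card_biUnion_le_card_mul K R _ ?_)
  · rintro ⟨a, b⟩ hab
    simp only [mem_filter, mem_product, mem_powerset] at hab
    obtain ⟨k, hk, hne⟩ := exists_ne_zero_of_sum_ne_zero (h0 a hab.1.1 b hab.1.2 hab.2)
    simp only [mem_biUnion, R, mem_filter, mem_product, mem_powerset]
    exact ⟨k, hk, hab.1, ⟨hab.1.1, left_ne_zero_of_mul hne⟩, ⟨hab.1.2, right_ne_zero_of_mul hne⟩,
      hab.2⟩
  · intro k hk
    refine card_disjoint_pairs_le s _ _ fun a ha b hb hab => ?_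
    simp only [mem_filter, mem_powerset] at ha hb
    have := (sum_eq_zero_iff_of_nonneg fun k hk => mul_nonneg (hf k hk a) (hg k hk b)).1
      (h1 a ha.1 b hb.1 hab) k hk
    exact (mul_ne_zero ha.2 hb.2) this

/-! ### Independent subsets and balanced subfamilies -/

open Finset in
/-- A set on which a reflexive relation has at most `D` elements related to each element has an
independent subset of at least a `D`-th of its size. -/
theorem exists_independent_subset {α : Type*} [DecidableEq α] (E : Finset α)
    (r : α → α → Prop) [DecidableRel r] (hr : ∀ a, r a a) (hs : ∀ a b, r a b → r b a) (D : ℕ)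
    (hD : ∀ a ∈ E, (E.filter (r a)).card ≤ D) :
    ∃ M ⊆ E, (∀ a ∈ M, ∀ b ∈ M, a ≠ b → ¬ r a b) ∧ E.card ≤ M.card * D := by
  classical
  let F := E.powerset.filter fun M => ∀ a ∈ M, ∀ b ∈ M, a ≠ b → ¬ r a b
  -- For an independent subset of maximal size, the related classes of its elements cover `E`.
  obtain ⟨M, hM, hmax⟩ := F.exists_max_image card ⟨∅, by simp [F]⟩
  simp only [F, mem_filter, mem_powerset] at hM
  refine ⟨M, hM.1, hM.2, ?_⟩
  refine le_trans (card_le_card (t := M.biUnion fun a => E.filter (r a)) fun e he => ?_)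
    (card_biUnion_le_card_mul M _ _ fun a ha => hD a (hM.1 ha))
  by_contra hcon
  simp only [mem_biUnion, mem_filter, not_exists, not_and] at hcon
  have hne : e ∉ M := fun h => hcon e h he (hr e)
  have := hmax (insert e M) (by
    simp only [F, mem_filter, mem_powerset]
    refine ⟨insert_subset he hM.1, ?_⟩
    intro a ha b hb hab
    rcases mem_insert.1 ha with rfl | ha' <;> rcases mem_insert.1 hb with rfl | hb'
    · exact absurd rfl hab
    · exact fun h => hcon b hb' he (hs _ _ h)
    · exact fun h => hcon a ha' he h
    · exact hM.2 a ha' b hb' hab)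
  rw [card_insert_of_notMem hne] at this
  omega

/-- A family of sets of size at most `2 * N / 3` whose union is larger than that has a subfamily
whose union has a size between `N / 3` and `2 * N / 3`. -/
theorem exists_balanced_subfamily {V : Type*} [DecidableEq V] (P : Finset (Finset V)) (N : ℕ)
    (hN : 0 < N) (hP : ∀ p ∈ P, 3 * p.card ≤ 2 * N) (hU : 2 * N < 3 * (P.biUnion id).card) :
    ∃ Q ⊆ P, N ≤ 3 * (Q.biUnion id).card ∧ 3 * (Q.biUnion id).card ≤ 2 * N := by
  classical
  by_cases h : ∃ p ∈ P, N ≤ 3 * p.card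
  · obtain ⟨p, hp, hpN⟩ := h
    exact ⟨{p}, by simpa using hp, by simpa using hpN, by simpa using hP p hp⟩
  push Not at h
  -- All members are now smaller than `N / 3`, so a minimal subfamily that reaches `N / 3`
  -- overshoots by less than `N / 3`.
  obtain ⟨Q, hQ, hmin⟩ := (P.powerset.filter fun Q => N ≤ 3 * (Q.biUnion id).card).exists_min_image
    Finset.card ⟨P, by simp; omega⟩
  simp only [Finset.mem_filter, Finset.mem_powerset] at hQ hmin
  refine ⟨Q, hQ.1, hQ.2, ?_⟩
  obtain ⟨p, hp⟩ : Q.Nonempty := by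
    rw [Finset.nonempty_iff_ne_empty]
    rintro rfl
    simp at hQ
    omega
  have h1 : 3 * ((Q.erase p).biUnion id).card < N := by
    by_contra hcon
    have := hmin (Q.erase p) ⟨(Finset.erase_subset _ _).trans hQ.1, by omega⟩
    have := Finset.card_erase_lt_of_mem hp
    omega
  have h2 : (Q.biUnion id).card ≤ p.card + ((Q.erase p).biUnion id).card := by
    conv_lhs => rw [← Finset.insert_erase hp, Finset.biUnion_insert]
    exact Finset.card_union_le _ _
  have h3 := h p (hQ.1 hp)
  omega

/-! ### Balanced factorization of monotonic structured-decomposable circuits -/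

namespace Circuit

variable {V : Type}

theorem inputs_eq_empty {c : Circuit V} {n : c.U} {Y : Finset V} {f : (Y → Bool) → ℝ}
    (h : c.kind n = .input Y f) : c.inputs n = ∅ :=
  (c.inputs_eq_empty_iff n).2 ⟨Y, f, h⟩

theorem inputs_nonempty_of_product {c : Circuit V} {n : c.U} (h : c.kind n = .product) :
    (c.inputs n).Nonempty := by
  rw [Finset.nonempty_iff_ne_empty, Ne, c.inputs_eq_empty_iff]
  rintro ⟨Y, f, hf⟩
  rw [h] at hf
  cases hf

theorem inputs_nonempty_of_sum {c : Circuit V} {n : c.U} {w : c.U → ℝ}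
    (h : c.kind n = .sum w) : (c.inputs n).Nonempty := by
  rw [Finset.nonempty_iff_ne_empty, Ne, c.inputs_eq_empty_iff]
  rintro ⟨Y, f, hf⟩
  rw [h] at hf
  cases hf

theorem scope_subset_of_mem_inputs [DecidableEq V] {c : Circuit V} {n i : c.U}
    (hi : i ∈ c.inputs n) : c.scope i ⊆ c.scope n := by
  cases hk : c.kind n with
  | input Y f => simp [inputs_eq_empty hk] at hi
  | product => rw [scope_product hk]; exact Finset.subset_biUnion_of_mem c.scope hi
  | sum w => rw [scope_sum hk]; exact Finset.subset_biUnion_of_mem c.scope hi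

theorem value_congr [DecidableEq V] {c : Circuit V} {x y : V → Bool} (n : c.U)
    (h : ∀ v ∈ c.scope n, x v = y v) : c.value x n = c.value y n := by
  induction n using c.acyclic.induction with
  | _ n ih =>
    have ih' : ∀ i ∈ c.inputs n, c.value x i = c.value y i := fun i hi =>
      ih i hi fun v hv => h v (scope_subset_of_mem_inputs hi hv)
    cases hk : c.kind n with
    | input Y f =>
      rw [value_input hk, value_input hk]
      rw [scope_input hk] at h
      congr 1
      ext v
      rw [h v v.2]
    | product =>
      rw [value_product hk, value_product hk]
      exact Finset.prod_congr rfl ih'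
    | sum w =>
      rw [value_sum hk, value_sum hk]
      exact Finset.sum_congr rfl fun i hi => by rw [ih' i hi]

theorem IsMonotonic.value_nonneg {c : Circuit V} (hc : c.IsMonotonic) (x : V → Bool) (n : c.U) :
    0 ≤ c.value x n := by
  induction n using c.acyclic.induction with
  | _ n ih =>
    cases hk : c.kind n with
    | input Y f =>
      rw [value_input hk]
      exact hc.2 n Y f hk _
    | product =>
      rw [value_product hk]
      exact Finset.prod_nonneg fun i hi => ih i hi
    | sum w =>
      rw [value_sum hk]
      exact Finset.sum_nonneg fun i hi => mul_nonneg (hc.1 n w hk i hi) (ih i hi)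

variable [DecidableEq V]

theorem IsSmooth.scope_eq {c : Circuit V} (hc : c.IsSmooth) {n i : c.U} {w : c.U → ℝ}
    (h : c.kind n = .sum w) (hi : i ∈ c.inputs n) : c.scope i = c.scope n := by
  refine (scope_subset_of_mem_inputs hi).antisymm ?_
  rw [scope_sum h]
  exact Finset.biUnion_subset.2 fun j hj => (hc n w h j hj i hi).subset

/-- If no input unit has the scope `S`, then product units of scope `S` split it properly. -/
theorem IsStructuredDecomposable.scope_ne {c : Circuit V} (hc : c.IsStructuredDecomposable)
    {S : Finset V} (hS : S.Nonempty) (hin : ∀ u Y f, c.kind u = .input Y f → Y ≠ S)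
    {n : c.U} (hn : c.kind n = .product) (hnS : c.scope n = S) {i : c.U} (hi : i ∈ c.inputs n) :
    c.scope i ≠ S := by
  intro hiS
  -- A lowest unit of scope `S` can only be a product. It shares the partition of `n`, so if `S`
  -- were a part, it would have an input of scope `S` below it.
  obtain ⟨m, hmS, hmin⟩ := c.acyclic.has_min {m | c.scope m = S} ⟨n, hnS⟩
  simp only [Set.mem_ofPred_eq] at hmS hmin
  cases hk : c.kind m with
  | input Y f =>
    rw [scope_input hk] at hmS
    exact hin m Y f hk hmS
  | sum w =>
    obtain ⟨j, hj⟩ := inputs_nonempty_of_sum hk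
    exact hmin j ((hc.1.scope_eq hk hj).trans hmS) hj
  | product =>
    have h1 : S ∈ c.partition n :=
      Finset.mem_erase.2 ⟨hS.ne_empty, Finset.mem_image.2 ⟨i, hi, hiS⟩⟩
    rw [hc.2.2 n m hn hk (hnS.trans hmS.symm)] at h1
    obtain ⟨j, hj, hjS⟩ := Finset.mem_image.1 (Finset.mem_erase.1 h1).2
    exact hmin j hjS hj

open Classical in
/-- The product units of scope `S`. -/
noncomputable def productsOn (c : Circuit V) (S : Finset V) : Finset c.U :=
  Finset.univ.filter fun n => c.kind n = .product ∧ c.scope n = S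

theorem mem_productsOn {c : Circuit V} {S : Finset V} {n : c.U} :
    n ∈ c.productsOn S ↔ c.kind n = .product ∧ c.scope n = S := by
  simp [productsOn]

theorem card_productsOn_le (c : Circuit V) (S : Finset V) : (c.productsOn S).card ≤ c.size := by
  rw [Finset.card_eq_sum_ones, size]
  refine le_trans (Finset.sum_le_sum fun n hn => ?_)
    (Finset.sum_le_sum_of_subset (Finset.subset_univ _))
  exact Finset.card_pos.2 (inputs_nonempty_of_product (mem_productsOn.1 hn).1)

/-- The output of `c` is a combination of the units in `K`, with non-negative coefficients that
do not depend on the variables in `S`. -/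
def FactorsThrough (c : Circuit V) (K : Finset c.U) (S : Finset V) : Prop :=
  ∃ g : c.U → (V → Bool) → ℝ, (∀ n x, 0 ≤ g n x) ∧
    (∀ n ∈ K, ∀ x y, (∀ v ∉ S, x v = y v) → g n x = g n y) ∧
    ∀ x, c.value x c.output = ∑ n ∈ K, c.value x n * g n x

/-- By smoothness sum units keep the scope, so unfolding them downwards stays at scope `S` until
product units are reached. -/
theorem exists_combination_of_products {c : Circuit V} (hc : c.IsStructuredDecomposable)
    (hm : c.IsMonotonic) {S : Finset V} (hin : ∀ u Y f, c.kind u = .input Y f → Y ≠ S) (m : c.U)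
    (hmS : c.scope m = S) : ∃ a : c.U → ℝ, (∀ n, 0 ≤ a n) ∧
      ∀ x, c.value x m = ∑ n ∈ c.productsOn S, c.value x n * a n := by
  classical
  induction m using c.acyclic.induction with
  | _ m ih =>
    cases hk : c.kind m with
    | input Y f =>
      rw [scope_input hk] at hmS
      exact absurd hmS (hin m Y f hk)
    | product =>
      refine ⟨fun n => if n = m then 1 else 0, fun n => by positivity, fun x => ?_⟩
      simp [mem_productsOn, hk, hmS]
    | sum w =>
      choose! a ha hv using fun i hi => ih i hi ((hc.1.scope_eq hk hi).trans hmS)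
      refine ⟨fun n => ∑ i ∈ c.inputs m, w i * a i n, fun n => Finset.sum_nonneg fun i hi =>
        mul_nonneg (hm.1 m w hk i hi) (ha i hi n), fun x => ?_⟩
      rw [value_sum hk, Finset.sum_congr rfl fun i hi => by rw [hv i hi x]]
      simp only [Finset.mul_sum]
      rw [Finset.sum_comm]
      exact Finset.sum_congr rfl fun n _ => Finset.sum_congr rfl fun i _ => by ring

theorem FactorsThrough.products {c : Circuit V} (hc : c.IsStructuredDecomposable)
    (hm : c.IsMonotonic) {S : Finset V} (hin : ∀ u Y f, c.kind u = .input Y f → Y ≠ S)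
    (h : c.FactorsThrough (Finset.univ.filter fun n => c.scope n = S) S) :
    c.FactorsThrough (c.productsOn S) S := by
  obtain ⟨g, hg, hgS, hv⟩ := h
  simp only [Finset.mem_filter, Finset.mem_univ, true_and] at hgS
  choose! a ha hav using exists_combination_of_products hc hm hin
  refine ⟨fun n x => ∑ m with c.scope m = S, a m n * g m x, fun n x => Finset.sum_nonneg
    fun m hmS => mul_nonneg (ha m (by simpa using hmS) n) (hg m x), ?_, fun x => ?_⟩
  · intro n _ x y hxy
    exact Finset.sum_congr rfl fun m hmS => by rw [hgS m (by simpa using hmS) x y hxy]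
  · rw [hv, Finset.sum_congr rfl fun m hmS => by rw [hav m (by simpa using hmS) x]]
    simp only [Finset.mul_sum, Finset.sum_mul]
    rw [Finset.sum_comm]
    exact Finset.sum_congr rfl fun n _ => Finset.sum_congr rfl fun i _ => by ring

/-- A non-empty part is the scope of exactly one input. The statement as a sum serves to introduce
that input as a summation index. -/
theorem IsDecomposable.sum_filter_scope_eq {c : Circuit V} (hc : c.IsDecomposable) {n : c.U}
    (hn : c.kind n = .product) {P : Finset V} (hP : P ∈ c.partition n) (t : ℝ) :
    ∑ _i ∈ (c.inputs n).filter (fun i => c.scope i = P), t = t := by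
  obtain ⟨hPne, hP⟩ := Finset.mem_erase.1 hP
  obtain ⟨i, hi, hiP⟩ := Finset.mem_image.1 hP
  have : (c.inputs n).filter (fun i => c.scope i = P) = {i} := by
    ext j
    simp only [Finset.mem_filter, Finset.mem_singleton]
    constructor
    · rintro ⟨hj, hjP⟩
      by_contra hji
      have := hc n hn j hj i hi hji
      rw [hjP, hiP, disjoint_self] at this
      exact hPne this
    · rintro rfl
      exact ⟨hi, hiP⟩
  rw [this, Finset.sum_singleton]

/-- In each product of scope `S`, the input of scope `P` is singled out and the other inputs move
into the coefficient. By decomposability these do not depend on `P`. Terms are then regrouped by the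
singled-out input. -/
theorem FactorsThrough.part {c : Circuit V} (hc : c.IsDecomposable)
    (hm : c.IsMonotonic) {S P : Finset V}
    (hP : ∀ n ∈ c.productsOn S, P ∈ c.partition n) (hPS : P ⊆ S)
    (h : c.FactorsThrough (c.productsOn S) S) :
    c.FactorsThrough (Finset.univ.filter fun n => c.scope n = P) P := by
  obtain ⟨g, hg, hgS, hv⟩ := h
  refine ⟨fun i x => ∑ n ∈ (c.productsOn S).filter fun n => i ∈ c.inputs n,
    (∏ j ∈ (c.inputs n).erase i, c.value x j) * g n x, fun i x => Finset.sum_nonneg fun n _ =>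
    mul_nonneg (Finset.prod_nonneg fun j _ => hm.value_nonneg x j) (hg n x), ?_, fun x => ?_⟩
  · intro i hi x y hxy
    simp only [Finset.mem_filter, Finset.mem_univ, true_and] at hi
    refine Finset.sum_congr rfl fun n hn => ?_
    obtain ⟨hn, hin⟩ := Finset.mem_filter.1 hn
    rw [hgS n hn x y fun v hvS => hxy v fun hvP => hvS (hPS hvP)]
    congr 1
    refine Finset.prod_congr rfl fun j hj => value_congr j fun v hvj => hxy v fun hvP => ?_
    obtain ⟨hji, hj⟩ := Finset.mem_erase.1 hj
    exact Finset.disjoint_left.1 (hc n (mem_productsOn.1 hn).1 j hj i hin hji) hvj (hi ▸ hvP)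
  · rw [hv]
    simp only [Finset.mul_sum]
    rw [Finset.sum_congr rfl fun n hn =>
      (hc.sum_filter_scope_eq (mem_productsOn.1 hn).1 (hP n hn) _).symm]
    refine Eq.trans (Finset.sum_congr rfl fun n hn => Finset.sum_congr rfl fun i hi => ?_)
      (Finset.sum_comm' (t' := Finset.univ.filter fun n => c.scope n = P)
        (s' := fun i => (c.productsOn S).filter fun n => i ∈ c.inputs n)
        (f := fun n i => c.value x i * ((∏ j ∈ (c.inputs n).erase i, c.value x j) * g n x)) ?_)
    · rw [value_product (mem_productsOn.1 hn).1,
        ← Finset.mul_prod_erase _ _ (Finset.mem_filter.1 hi).1, mul_assoc]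
    · intro n i
      simp only [Finset.mem_filter, Finset.mem_univ, true_and]
      tauto

/-- A structured-decomposable monotonic circuit without large input units computes a sum of at
most `size` products of non-negative functions of the two sides of a balanced partition of the
variables. -/
theorem exists_balanced_factorization [Fintype V] (c : Circuit V)
    (hc : c.IsStructuredDecomposable) (hm : c.IsMonotonic)
    (hin : ∀ u Y f, c.kind u = .input Y f → 3 * Y.card ≤ 2 * Fintype.card V)
    (hout : c.scope c.output = Finset.univ) (hV : 0 < Fintype.card V) (x₀ : V → Bool)
    (hx₀ : c.value x₀ c.output ≠ 0) :
    ∃ (Y : Finset V) (K : Finset c.U) (f g : c.U → (V → Bool) → ℝ),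
      Fintype.card V ≤ 3 * Y.card ∧ 3 * Y.card ≤ 2 * Fintype.card V ∧
      (∀ n x, 0 ≤ f n x) ∧ (∀ n x, 0 ≤ g n x) ∧
      (∀ n ∈ K, ∀ x y, (∀ v ∈ Y, x v = y v) → f n x = f n y) ∧
      (∀ n ∈ K, ∀ x y, (∀ v ∉ Y, x v = y v) → g n x = g n y) ∧
      K.card ≤ c.size ∧ ∀ x, c.value x c.output = ∑ n ∈ K, f n x * g n x := by
  classical
  set N := Fintype.card V with hN
  have huniv : c.FactorsThrough (Finset.univ.filter fun n => c.scope n = Finset.univ)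
      Finset.univ := by
    refine ⟨fun n _ => if n = c.output then 1 else 0, fun n x => by positivity,
      fun n _ x y _ => rfl, fun x => ?_⟩
    simp [hout]
  -- A smallest scope above the threshold. No input unit has such a scope, and by minimality its
  -- parts are all at most two thirds.
  obtain ⟨S, hS, hmin⟩ := (Finset.univ.filter fun S : Finset V => 2 * N < 3 * S.card ∧
    c.FactorsThrough (Finset.univ.filter fun n => c.scope n = S) S).exists_min_image
    Finset.card ⟨Finset.univ, by
      simp only [Finset.mem_filter, Finset.mem_univ, true_and, Finset.card_univ]
      exact ⟨by omega, huniv⟩⟩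
  simp only [Finset.mem_filter, Finset.mem_univ, true_and] at hS hmin
  obtain ⟨hSN, hSf⟩ := hS
  have hSne : S.Nonempty := Finset.card_pos.1 (by omega)
  have hinS : ∀ u Y f, c.kind u = .input Y f → Y ≠ S := by
    rintro u Y f hu rfl
    have := hin u Y f hu
    omega
  have hprod := hSf.products hc hm hinS
  obtain ⟨n₀, hn₀⟩ : (c.productsOn S).Nonempty := by
    rw [Finset.nonempty_iff_ne_empty]
    intro he
    obtain ⟨g, -, -, hv⟩ := hprod
    rw [hv, he, Finset.sum_empty] at hx₀
    exact hx₀ rfl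
  have hpart : ∀ n ∈ c.productsOn S, c.partition n = c.partition n₀ := fun n hn =>
    hc.2.2 n n₀ (mem_productsOn.1 hn).1 (mem_productsOn.1 hn₀).1
      ((mem_productsOn.1 hn).2.trans (mem_productsOn.1 hn₀).2.symm)
  have hsub : ∀ P ∈ c.partition n₀, P ⊂ S := by
    intro P hP
    obtain ⟨i, hi, rfl⟩ := Finset.mem_image.1 (Finset.mem_erase.1 hP).2
    exact ((scope_subset_of_mem_inputs hi).trans
      (mem_productsOn.1 hn₀).2.subset).ssubset_of_ne
      (hc.scope_ne hSne hinS (mem_productsOn.1 hn₀).1 (mem_productsOn.1 hn₀).2 hi)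
  obtain ⟨Q, hQ, hQ1, hQ2⟩ := exists_balanced_subfamily (c.partition n₀) N hV (by
      intro P hP
      by_contra hcon
      have h1 := hmin P ⟨by omega, hprod.part hc.2.1 hm (fun n hn => hpart n hn ▸ hP)
        (hsub P hP).subset⟩
      have h2 := Finset.card_lt_card (hsub P hP)
      omega) (by
      refine hSN.trans_le (Nat.mul_le_mul_left _ (Finset.card_le_card fun v hv => ?_))
      rw [← (mem_productsOn.1 hn₀).2, scope_product (mem_productsOn.1 hn₀).1] at hv
      obtain ⟨i, hi, hvi⟩ := Finset.mem_biUnion.1 hv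
      exact Finset.mem_biUnion.2 ⟨c.scope i, Finset.mem_erase.2
        ⟨Finset.nonempty_iff_ne_empty.1 ⟨v, hvi⟩, Finset.mem_image_of_mem _ hi⟩, hvi⟩)
  obtain ⟨g, hg, hgS, hv⟩ := hprod
  set Y := Q.biUnion id with hY
  have hYS : Y ⊆ S := Finset.biUnion_subset.2 fun P hP => (hsub P (hQ hP)).subset
  -- The cut `Y` is a union of parts common to all products of scope `S`, so every input lies inside
  -- `Y` or is disjoint from it.
  refine ⟨Y, c.productsOn S, fun n x => ∏ i ∈ (c.inputs n).filter (fun i => c.scope i ⊆ Y),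
    c.value x i, fun n x => (∏ i ∈ (c.inputs n).filter (fun i => ¬ c.scope i ⊆ Y),
    c.value x i) * g n x, hQ1, hQ2, fun n x => Finset.prod_nonneg fun i _ => hm.value_nonneg x i,
    fun n x => mul_nonneg (Finset.prod_nonneg fun i _ => hm.value_nonneg x i) (hg n x),
    ?_, ?_, c.card_productsOn_le S, fun x => ?_⟩
  · intro n hn x y hxy
    exact Finset.prod_congr rfl fun i hi => value_congr i fun v hvi =>
      hxy v ((Finset.mem_filter.1 hi).2 hvi)
  · intro n hn x y hxy
    dsimp only
    rw [hgS n hn x y fun v hvS => hxy v fun hvY => hvS (hYS hvY)]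
    congr 1
    refine Finset.prod_congr rfl fun i hi => value_congr i fun v hvi => hxy v fun hvY => ?_
    obtain ⟨hi, hiY⟩ := Finset.mem_filter.1 hi
    obtain ⟨P, hP, hvP⟩ := Finset.mem_biUnion.1 hvY
    have hP' := hQ hP
    rw [← hpart n hn] at hP'
    obtain ⟨j, hj, hjP⟩ := Finset.mem_image.1 (Finset.mem_erase.1 hP').2
    have hij : i ≠ j := by
      rintro rfl
      exact hiY (hjP ▸ Finset.subset_biUnion_of_mem id hP)
    exact Finset.disjoint_left.1 (hc.2.1 n (mem_productsOn.1 hn).1 i hi j hj hij) hvi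
      (hjP ▸ hvP)
  · rw [hv]
    refine Finset.sum_congr rfl fun n hn => ?_
    rw [value_product (mem_productsOn.1 hn).1, ← mul_assoc, Finset.prod_filter_mul_prod_filter_not]

end Circuit

/-! ### Induced matchings across balanced cuts -/

/-- Two pairs of vertices that share a vertex or are joined by an edge. -/
def SimpleGraph.Touching {V : Type*} (G : SimpleGraph V) (p q : V × V) : Prop :=
  ∃ u v, (u = p.1 ∨ u = p.2) ∧ (v = q.1 ∨ v = q.2) ∧ (u = v ∨ G.Adj u v)

theorem SimpleGraph.Touching.symm {V : Type*} {G : SimpleGraph V} {p q : V × V}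
    (h : G.Touching p q) : G.Touching q p := by
  obtain ⟨u, v, hu, hv, h⟩ := h
  exact ⟨v, u, hv, hu, h.imp Eq.symm fun h => h.symm⟩

-- The endpoints of `p` and their neighbours are at most `2 * (d + 1)` vertices, and each vertex
-- belongs to at most `2 * d` ordered edges.
open Classical in
theorem card_filter_touching_le {V : Type} [Fintype V] {G : SimpleGraph V} {d : ℕ}
    (hd : DegreeAtMost G d) (E : Finset (V × V)) (hE : ∀ p ∈ E, G.Adj p.1 p.2) (p : V × V) :
    (E.filter (G.Touching p)).card ≤ 2 * (d + 1) * (2 * d) := by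
  let W : Finset V := ({p.1, p.2} : Finset V).biUnion fun u => insert u (G.neighborFinset u)
  have hW : W.card ≤ 2 * (d + 1) := by
    refine (Finset.card_biUnion_le_card_mul _ _ (d + 1) fun u _ => ?_).trans
      (Nat.mul_le_mul_right _ Finset.card_le_two)
    refine (Finset.card_insert_le _ _).trans ?_
    rw [G.card_neighborFinset_eq_degree]
    have := hd u
    omega
  let T : V → Finset (V × V) := fun v =>
    (G.neighborFinset v).image (fun w => (v, w)) ∪ (G.neighborFinset v).image (fun w => (w, v))
  have hT : ∀ v ∈ W, (T v).card ≤ 2 * d := by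
    intro v _
    have := hd v
    refine (Finset.card_union_le _ _).trans ?_
    rw [two_mul]
    refine add_le_add ?_ ?_ <;> refine Finset.card_image_le.trans ?_ <;>
      rwa [G.card_neighborFinset_eq_degree]
  refine le_trans (Finset.card_le_card (t := W.biUnion T) ?_)
    ((Finset.card_biUnion_le_card_mul _ _ _ hT).trans (Nat.mul_le_mul_right _ hW))
  rintro ⟨a, b⟩ hq
  obtain ⟨hq, u, v, hu, hv, huv⟩ := Finset.mem_filter.1 hq
  have hab : G.Adj a b := hE _ hq
  refine Finset.mem_biUnion.2 ⟨v, Finset.mem_biUnion.2 ⟨u, by simpa using hu, ?_⟩, ?_⟩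
  · rcases huv with rfl | h
    · simp
    · simp [h]
  · rcases hv with rfl | rfl
    · exact Finset.mem_union_left _ (Finset.mem_image.2 ⟨b, by simpa using hab, rfl⟩)
    · exact Finset.mem_union_right _ (Finset.mem_image.2 ⟨a, by simpa using hab.symm, rfl⟩)

open Classical in
/-- An expander of bounded degree has a large induced matching across each balanced cut. -/
theorem exists_induced_matching {V : Type} [Fintype V] {G : SimpleGraph V} {d : ℕ} {ε : ℝ}
    (hε : 0 ≤ ε) (hd : DegreeAtMost G d) (hG : HasExpansion G ε) (Y : Finset V)
    (hY1 : Fintype.card V ≤ 3 * Y.card) (hY2 : 3 * Y.card ≤ 2 * Fintype.card V) :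
    ∃ M : Finset (V × V), (∀ p ∈ M, p.1 ∈ Y ∧ p.2 ∉ Y ∧ G.Adj p.1 p.2) ∧
      (∀ p ∈ M, ∀ q ∈ M, p ≠ q → ¬ G.Touching p q) ∧
      ε * Fintype.card V ≤ 3 * (M.card * (2 * (d + 1) * (2 * d)) : ℕ) := by
  have hE : ε * Fintype.card V ≤ 3 * ((G.interedges Y Yᶜ).card : ℝ) := by
    -- Applied to whichever of `Y` and `Yᶜ` has at most half of the vertices; both have at least a
    -- third.
    have key : ∀ S : Finset V, Fintype.card V ≤ 3 * S.card → 2 * S.card ≤ Fintype.card V →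
        ε * Fintype.card V ≤ 3 * ((G.interedges S Sᶜ).card : ℝ) := by
      intro S h1 h2
      have h3 := hG S h2
      have h4 : (Fintype.card V : ℝ) ≤ 3 * S.card := by exact_mod_cast h1
      nlinarith
    rcases le_total (2 * Y.card) (Fintype.card V) with h | h
    · exact key Y hY1 h
    · have hc := Finset.card_add_card_compl Y
      have := key Yᶜ (by omega) (by omega)
      have hsymm : Std.Symm G.Adj := G.symm
      rwa [compl_compl, SimpleGraph.interedges, Rel.card_interedges_comm] at this
  obtain ⟨M, hM, hMr, hMc⟩ := exists_independent_subset (G.interedges Y Yᶜ) G.Touching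
    (fun p => ⟨p.1, p.1, .inl rfl, .inl rfl, .inl rfl⟩) (fun p q h => h.symm) _
    (fun p _ => card_filter_touching_le hd _ (fun q hq =>
      (G.mem_interedges_iff.1 hq).2.2) p)
  refine ⟨M, fun p hp => ?_, hMr, hE.trans ?_⟩
  · have := G.mem_interedges_iff.1 (hM hp)
    simpa using this
  · have : ((G.interedges Y Yᶜ).card : ℝ) ≤ (M.card * (2 * (d + 1) * (2 * d)) : ℕ) := by
      exact_mod_cast hMc
    linarith

open Classical in
/-- The assignment that sets the first vertices of the pairs in `a` and the second vertices of the
pairs in `b`. -/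
noncomputable def matchingAssignment {V : Type} (a b : Finset (V × V)) (v : V) : Bool :=
  decide ((∃ p ∈ a, p.1 = v) ∨ ∃ p ∈ b, p.2 = v)

/-- Since the matching is induced, an edge with both endpoints set is a matching edge, and it has
both endpoints set exactly when its pair lies in `a ∩ b`. -/
theorem udisj_matchingAssignment {V : Type} [Fintype V] [DecidableEq V] {G : SimpleGraph V}
    {M : Finset (V × V)} (hM : ∀ p ∈ M, G.Adj p.1 p.2) (hr : ∀ p ∈ M, ∀ q ∈ M, p ≠ q → ¬ G.Touching p q)
    {a b : Finset (V × V)} (ha : a ⊆ M) (hb : b ⊆ M) :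
    udisj G (matchingAssignment a b) = (1 - ((a ∩ b).card : ℝ)) ^ 2 := by
  classical
  have hinj : Set.InjOn (fun p : V × V => s(p.1, p.2)) (a ∩ b : Finset (V × V)) := by
    intro p hp q hq hpq
    by_contra hne
    have hp' := ha (Finset.mem_inter.1 hp).1
    have hq' := ha (Finset.mem_inter.1 hq).1
    apply hr p hp' q hq' hne
    rcases Sym2.eq_iff.1 hpq with h | h
    · exact ⟨p.1, q.1, .inl rfl, .inl rfl, .inl h.1⟩
    · exact ⟨p.1, q.2, .inl rfl, .inr rfl, .inl h.1⟩
  have hsub : (a ∩ b).image (fun p : V × V => s(p.1, p.2)) ⊆ G.edgeFinset := by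
    intro e he
    obtain ⟨p, hp, rfl⟩ := Finset.mem_image.1 he
    simpa using hM p (ha (Finset.mem_inter.1 hp).1)
  unfold udisj
  congr 2
  rw [← Finset.card_image_of_injOn hinj, Finset.card_eq_sum_ones, Nat.cast_sum,
    ← Finset.sum_filter_add_sum_filter_not G.edgeFinset
      (fun e => e ∈ (a ∩ b).image (fun p : V × V => s(p.1, p.2)))]
  rw [Finset.filter_mem_eq_inter, Finset.inter_eq_right.2 hsub]
  conv_rhs => rw [← add_zero (Finset.sum _ _)]
  congr 1
  · refine Finset.sum_congr rfl fun e he => ?_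
    obtain ⟨p, hp, rfl⟩ := Finset.mem_image.1 he
    obtain ⟨hpa, hpb⟩ := Finset.mem_inter.1 hp
    have h1 : matchingAssignment a b p.1 = true := by
      simp only [matchingAssignment, decide_eq_true_eq]
      exact .inl ⟨p, hpa, rfl⟩
    have h2 : matchingAssignment a b p.2 = true := by
      simp only [matchingAssignment, decide_eq_true_eq]
      exact .inr ⟨p, hpb, rfl⟩
    simp [h1, h2]
  · refine Finset.sum_eq_zero fun e he => ?_
    induction e using Sym2.ind with
    | _ u v =>
    obtain ⟨huv, hnot⟩ := Finset.mem_filter.1 he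
    have huv : G.Adj u v := by simpa using huv
    rw [Sym2.map_mk, Sym2.mul_mk]
    by_contra hne
    have hu : matchingAssignment a b u = true := by
      by_contra h
      simp [h] at hne
    have hv : matchingAssignment a b v = true := by
      by_contra h
      simp [h] at hne
    simp only [matchingAssignment, decide_eq_true_eq] at hu hv
    apply hnot
    have hpq : ∀ p ∈ M, ∀ q ∈ M, (u = p.1 ∨ u = p.2) → (v = q.1 ∨ v = q.2) → p = q := by
      intro p hp q hq hu hv
      by_contra hne
      exact hr p hp q hq hne ⟨u, v, hu, hv, .inr huv⟩
    rcases hu with ⟨p, hp, hpu⟩ | ⟨p, hp, hpu⟩ <;> rcases hv with ⟨q, hq, hqv⟩ | ⟨q, hq, hqv⟩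
    · have := hpq p (ha hp) q (ha hq) (.inl hpu.symm) (.inl hqv.symm)
      subst this
      exact absurd (hpu.symm.trans hqv) huv.ne
    · have := hpq p (ha hp) q (hb hq) (.inl hpu.symm) (.inr hqv.symm)
      subst this
      exact Finset.mem_image.2 ⟨p, Finset.mem_inter.2 ⟨hp, hq⟩, by rw [hpu, hqv]⟩
    · have := hpq p (hb hp) q (ha hq) (.inr hpu.symm) (.inl hqv.symm)
      subst this
      exact Finset.mem_image.2 ⟨p, Finset.mem_inter.2 ⟨hq, hp⟩, by rw [hpu, hqv, Sym2.eq_swap]⟩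
    · have := hpq p (hb hp) q (hb hq) (.inr hpu.symm) (.inr hqv.symm)
      subst this
      exact absurd (hpu.symm.trans hqv) huv.ne

/-! ### Size lower bound for expanders -/

/-- The lower bound for monotonic structured-decomposable circuits that compute the unique
disjointness function of an expander. -/
theorem Circuit.two_rpow_le_size {V : Type} [Fintype V] [DecidableEq V] {G : SimpleGraph V}
    {d : ℕ} {ε : ℝ} (hε : 0 ≤ ε) (hd : DegreeAtMost G d) (hd0 : 0 < d) (hG : HasExpansion G ε)
    (hV : 0 < Fintype.card V) (c : Circuit V)
    (hc : c.IsStructuredDecomposable) (hm : c.IsMonotonic)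
    (hin : ∀ u Y f, c.kind u = .input Y f → 3 * Y.card ≤ 2 * Fintype.card V)
    (hF : c.Computes (udisj G)) :
    (2 : ℝ) ^ (ε / (24 * (d + 1) * d) * (Fintype.card V : ℝ)) ≤ (c.size : ℝ) := by
  classical
  have h0 : udisj G (matchingAssignment ∅ ∅) = 1 := by
    rw [udisj_matchingAssignment (M := ∅) (by simp) (by simp) (by simp) (by simp)]
    simp
  obtain ⟨Y, K, f, g, hY1, hY2, hf, hg, hfY, hgY, hK, hv⟩ := c.exists_balanced_factorization hc hm
    hin hF.1 hV (matchingAssignment ∅ ∅) (by rw [hF.2, h0]; exact one_ne_zero)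
  obtain ⟨M, hM, hMr, hMc⟩ := exists_induced_matching hε hd hG Y hY1 hY2
  -- First vertices lie in `Y` and second vertices outside, so the left factors see only `a` and the
  -- right factors only `b`.
  have hsplit : ∀ a ⊆ M, ∀ b ⊆ M,
      ∑ n ∈ K, f n (matchingAssignment a ∅) * g n (matchingAssignment ∅ b) =
        (1 - ((a ∩ b).card : ℝ)) ^ 2 := by
    intro a ha b hb
    rw [← udisj_matchingAssignment (fun p hp => (hM p hp).2.2) hMr ha hb, ← hF.2, hv]
    refine Finset.sum_congr rfl fun n hn => ?_
    congr 1
    · refine hfY n hn _ _ fun v hvY => ?_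
      simp only [matchingAssignment, Finset.notMem_empty, false_and, exists_false, or_false]
      congr 1
      refine propext ⟨.inl, fun h => h.resolve_right ?_⟩
      rintro ⟨p, hp, rfl⟩
      exact (hM p (hb hp)).2.1 hvY
    · refine hgY n hn _ _ fun v hvY => ?_
      simp only [matchingAssignment, Finset.notMem_empty, false_and, exists_false, false_or]
      congr 1
      refine propext ⟨.inr, fun h => h.resolve_left ?_⟩
      rintro ⟨p, hp, rfl⟩
      exact hvY (hM p (ha hp)).1
  have h3 := three_pow_le_of_factorization M K (fun n a => f n (matchingAssignment a ∅))
    (fun n b => g n (matchingAssignment ∅ b)) (fun n _ a => hf n _) (fun n _ b => hg n _)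
    (fun a ha b hb hab => by
      rw [hsplit a ha b hb, Finset.disjoint_iff_inter_eq_empty.1 hab]
      simp)
    (fun a ha b hb hab => by
      rw [hsplit a ha b hb, hab]
      simp)
  have h4 : (3 / 2 : ℝ) ^ M.card ≤ c.size := by
    rw [div_pow, div_le_iff₀ (by positivity)]
    exact_mod_cast h3.trans (Nat.mul_le_mul_right _ hK)
  have h5 : ε / (24 * (d + 1) * d) * (Fintype.card V : ℝ) ≤ (M.card : ℝ) / 2 := by
    have hd' : (0 : ℝ) < d := by exact_mod_cast hd0
    rw [div_mul_eq_mul_div, div_le_iff₀ (by positivity)]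
    push_cast at hMc
    linarith
  refine (Real.rpow_le_rpow_of_exponent_le one_le_two h5).trans (le_trans ?_ h4)
  -- This is `2 ≤ (3 / 2) ^ 2`, and the reason for the factor 24, twice the 12 from the matching
  -- bound.
  have h6 : ((2 : ℝ) ^ ((M.card : ℝ) / 2)) ^ 2 ≤ ((3 / 2 : ℝ) ^ M.card) ^ 2 := by
    rw [← Real.rpow_natCast, ← Real.rpow_mul (by norm_num), ← pow_mul, mul_comm M.card, pow_mul]
    have : ((M.card : ℝ) / 2 * ((2 : ℕ) : ℝ)) = (M.card : ℝ) := by push_cast; ring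
    rw [this, Real.rpow_natCast]
    exact pow_le_pow_left₀ (by norm_num) (by norm_num) _
  exact le_of_sq_le_sq h6 (by positivity)

/-! ### Spectral gap of the Margulis graph -/

-- Pointwise, `s² - t² = (s - t)(s + t) ≤ 8 (s - t)² + (s² + t²) / 16` by the inequality of means.
open Finset in
theorem sum_sq_norm_le_sum_comp {V : Type*} [Fintype V] (a : V → ℂ) (T : Equiv.Perm V)
    (A : Finset V) :
    ∑ z ∈ A, ‖a z‖ ^ 2 ≤ ∑ z ∈ A, ‖a (T z)‖ ^ 2 + 8 * ∑ z, ‖a z - a (T z)‖ ^ 2 +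
      1 / 8 * ∑ z, ‖a z‖ ^ 2 := by
  have h1 : ∑ z ∈ A, (‖a z‖ ^ 2 - ‖a (T z)‖ ^ 2) ≤
      ∑ z ∈ A, (8 * ‖a z - a (T z)‖ ^ 2 + 1 / 16 * (‖a z‖ ^ 2 + ‖a (T z)‖ ^ 2)) := by
    refine sum_le_sum fun z _ => ?_
    have h := abs_norm_sub_norm_le (a z) (a (T z))
    have h' : (‖a z‖ - ‖a (T z)‖) ^ 2 ≤ ‖a z - a (T z)‖ ^ 2 := sq_le_sq' (by
      linarith [(abs_le.1 h).1]) (abs_le.1 h).2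
    nlinarith [sq_nonneg (16 * (‖a z‖ - ‖a (T z)‖) - (‖a z‖ + ‖a (T z)‖)),
      sq_nonneg (‖a z‖ - ‖a (T z)‖)]
  have h2 : ∑ z ∈ A, (8 * ‖a z - a (T z)‖ ^ 2 + 1 / 16 * (‖a z‖ ^ 2 + ‖a (T z)‖ ^ 2)) ≤
      ∑ z, (8 * ‖a z - a (T z)‖ ^ 2 + 1 / 16 * (‖a z‖ ^ 2 + ‖a (T z)‖ ^ 2)) :=
    sum_le_sum_of_subset_of_nonneg (subset_univ _) fun z _ _ => by positivity
  have h3 : ∑ z, ‖a (T z)‖ ^ 2 = ∑ z, ‖a z‖ ^ 2 := Equiv.sum_comp T fun z => ‖a z‖ ^ 2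
  simp only [sum_add_distrib, sum_sub_distrib, ← mul_sum] at h1 h2
  linarith

open Finset in
/-- If two permutations map `Q` to disjoint subsets of `C`, then a function that is almost
invariant under both has at most about half of its mass on `C` in `Q`. -/
theorem two_mul_sum_sq_norm_le {V : Type*} [Fintype V] (a : V → ℂ) (T S : Equiv.Perm V)
    (Q C : Finset V) (hT : ∀ z ∈ Q, T z ∈ C) (hS : ∀ z ∈ Q, S z ∈ C)
    (hd : ∀ z ∈ Q, ∀ w ∈ Q, T z ≠ S w) :
    2 * ∑ z ∈ Q, ‖a z‖ ^ 2 ≤ ∑ z ∈ C, ‖a z‖ ^ 2 + 8 * (∑ z, ‖a z - a (T z)‖ ^ 2 +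
      ∑ z, ‖a z - a (S z)‖ ^ 2) + 1 / 4 * ∑ z, ‖a z‖ ^ 2 := by
  classical
  have h1 := sum_sq_norm_le_sum_comp a T Q
  have h2 := sum_sq_norm_le_sum_comp a S Q
  have h3 : ∑ z ∈ Q, ‖a (T z)‖ ^ 2 + ∑ z ∈ Q, ‖a (S z)‖ ^ 2 ≤ ∑ z ∈ C, ‖a z‖ ^ 2 := by
    rw [← sum_image (f := fun z => ‖a z‖ ^ 2) T.injective.injOn,
      ← sum_image (f := fun z => ‖a z‖ ^ 2) S.injective.injOn, ← sum_union]
    · refine sum_le_sum_of_subset_of_nonneg (union_subset ?_ ?_) fun z _ _ => by positivity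
      · exact image_subset_iff.2 hT
      · exact image_subset_iff.2 hS
    · rw [disjoint_left]
      intro z hz hz'
      obtain ⟨u, hu, rfl⟩ := mem_image.1 hz
      obtain ⟨w, hw, hwu⟩ := mem_image.1 hz'
      exact hd u hu w hw hwu.symm
  linarith

/-- Below `m / 4` nothing wraps around, so inside the box the shears act as they do on integer
points. -/
theorem ZMod.valMinAbs_add_of_lt {m : ℕ} [NeZero m] {x y : ZMod m} (hx : 4 * |x.valMinAbs| < m)
    (hy : 4 * |y.valMinAbs| < m) : (x + y).valMinAbs = x.valMinAbs + y.valMinAbs := by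
  rw [ZMod.valMinAbs_spec]
  refine ⟨by push_cast [ZMod.coe_valMinAbs]; rfl, ?_, ?_⟩ <;>
    grind

theorem ZMod.valMinAbs_sub_of_lt {m : ℕ} [NeZero m] {x y : ZMod m} (hx : 4 * |x.valMinAbs| < m)
    (hy : 4 * |y.valMinAbs| < m) : (x - y).valMinAbs = x.valMinAbs - y.valMinAbs := by
  rw [ZMod.valMinAbs_spec]
  refine ⟨by push_cast [ZMod.coe_valMinAbs]; rfl, ?_, ?_⟩ <;>
    grind

/-- The shear `(x, y) ↦ (x + y, y)`. -/
def shearLeft (R : Type*) [AddCommGroup R] : Equiv.Perm (R × R) where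
  toFun z := (z.1 + z.2, z.2)
  invFun z := (z.1 - z.2, z.2)
  left_inv z := by simp
  right_inv z := by simp

/-- The shear `(x, y) ↦ (x, y + x)`. -/
def shearRight (R : Type*) [AddCommGroup R] : Equiv.Perm (R × R) where
  toFun z := (z.1, z.2 + z.1)
  invFun z := (z.1, z.2 - z.1)
  left_inv z := by simp
  right_inv z := by simp

/-- The box of radius `m / 4` around the origin of `(ZMod m)²`. -/
def InBox {m : ℕ} (z : ZMod m × ZMod m) : Prop :=
  4 * |z.1.valMinAbs| < (m : ℤ) ∧ 4 * |z.2.valMinAbs| < (m : ℤ)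

open Finset Classical in
/-- A function on `(ZMod m)²` that vanishes at the origin and is almost invariant under the shears
has a large part of its mass outside of the box of radius `m / 4`. -/
theorem sum_sq_norm_le_of_shears {m : ℕ} [NeZero m] (a : ZMod m × ZMod m → ℂ) (h0 : a 0 = 0) :
    ∑ z, ‖a z‖ ^ 2 ≤ 4 * ∑ z with ¬ InBox z,
      ‖a z‖ ^ 2 + 32 * (∑ z, ‖a z - a (shearLeft _ z)‖ ^ 2 +
        ∑ z, ‖a z - a (shearRight _ z)‖ ^ 2) := by
  -- Two opposite half-open quadrants `p` and their rotation `q` partition the non-zero points. On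
  -- `p` inside the box the shears have images in `p` separated by the diagonal; on `q` the inverse
  -- shears do the same.
  obtain ⟨p, hpd⟩ : ∃ p : ZMod m × ZMod m → Prop, ∀ z, p z ↔
      (0 < z.1.valMinAbs ∧ 0 ≤ z.2.valMinAbs ∨ z.1.valMinAbs < 0 ∧ z.2.valMinAbs ≤ 0) :=
    ⟨_, fun _ => Iff.rfl⟩
  obtain ⟨q, hqd⟩ : ∃ q : ZMod m × ZMod m → Prop, ∀ z, q z ↔
      (z.1.valMinAbs ≤ 0 ∧ 0 < z.2.valMinAbs ∨ 0 ≤ z.1.valMinAbs ∧ z.2.valMinAbs < 0) :=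
    ⟨_, fun _ => Iff.rfl⟩
  have hB : ∀ z, InBox z → (shearLeft (ZMod m) z).1.valMinAbs = z.1.valMinAbs + z.2.valMinAbs ∧
      (shearLeft (ZMod m) z).2.valMinAbs = z.2.valMinAbs ∧
      (shearRight (ZMod m) z).1.valMinAbs = z.1.valMinAbs ∧
      (shearRight (ZMod m) z).2.valMinAbs = z.2.valMinAbs + z.1.valMinAbs ∧
      ((shearLeft (ZMod m)).symm z).1.valMinAbs = z.1.valMinAbs - z.2.valMinAbs ∧
      ((shearLeft (ZMod m)).symm z).2.valMinAbs = z.2.valMinAbs ∧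
      ((shearRight (ZMod m)).symm z).1.valMinAbs = z.1.valMinAbs ∧
      ((shearRight (ZMod m)).symm z).2.valMinAbs = z.2.valMinAbs - z.1.valMinAbs := fun z hz =>
    ⟨ZMod.valMinAbs_add_of_lt hz.1 hz.2, rfl, rfl, ZMod.valMinAbs_add_of_lt hz.2 hz.1,
      ZMod.valMinAbs_sub_of_lt hz.1 hz.2, rfl, rfl, ZMod.valMinAbs_sub_of_lt hz.2 hz.1⟩
  have h1 := two_mul_sum_sq_norm_le a (shearLeft _) (shearRight _)
    (univ.filter fun z => p z ∧ InBox z) (univ.filter p) (by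
      intro z hz
      obtain ⟨hz, hzB⟩ : p z ∧ InBox z := by simpa using hz
      have := hB z hzB
      simp only [mem_filter, mem_univ, true_and, hpd] at hz ⊢
      omega) (by
      intro z hz
      obtain ⟨hz, hzB⟩ : p z ∧ InBox z := by simpa using hz
      have := hB z hzB
      simp only [mem_filter, mem_univ, true_and, hpd] at hz ⊢
      omega) (by
      intro z hz w hw hzw
      obtain ⟨hz, hzB⟩ : p z ∧ InBox z := by simpa using hz
      obtain ⟨hw, hwB⟩ : p w ∧ InBox w := by simpa using hw
      have h1 := hB z hzB
      have h2 := hB w hwB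
      rw [hzw] at h1
      simp only [hpd] at hz hw
      omega)
  have h2 := two_mul_sum_sq_norm_le a (shearLeft _).symm (shearRight _).symm
    (univ.filter fun z => q z ∧ InBox z) (univ.filter q) (by
      intro z hz
      obtain ⟨hz, hzB⟩ : q z ∧ InBox z := by simpa using hz
      have := hB z hzB
      simp only [mem_filter, mem_univ, true_and, hqd] at hz ⊢
      omega) (by
      intro z hz
      obtain ⟨hz, hzB⟩ : q z ∧ InBox z := by simpa using hz
      have := hB z hzB
      simp only [mem_filter, mem_univ, true_and, hqd] at hz ⊢
      omega) (by
      intro z hz w hw hzw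
      obtain ⟨hz, hzB⟩ : q z ∧ InBox z := by simpa using hz
      obtain ⟨hw, hwB⟩ : q w ∧ InBox w := by simpa using hw
      have h1 := hB z hzB
      have h2 := hB w hwB
      rw [hzw] at h1
      simp only [hqd] at hz hw
      omega)
  have hsymm : ∀ T : Equiv.Perm (ZMod m × ZMod m),
      ∑ z, ‖a z - a (T.symm z)‖ ^ 2 = ∑ z, ‖a z - a (T z)‖ ^ 2 := by
    intro T
    rw [← Equiv.sum_comp T]
    exact sum_congr rfl fun z _ => by rw [T.symm_apply_apply, norm_sub_rev]
  rw [hsymm, hsymm] at h2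
  have hp : ∑ z with p z, ‖a z‖ ^ 2 =
      ∑ z with p z ∧ InBox z, ‖a z‖ ^ 2 + ∑ z with p z ∧ ¬ InBox z, ‖a z‖ ^ 2 := by
    rw [← filter_filter, ← filter_filter, sum_filter_add_sum_filter_not]
  have hq : ∑ z with q z, ‖a z‖ ^ 2 =
      ∑ z with q z ∧ InBox z, ‖a z‖ ^ 2 + ∑ z with q z ∧ ¬ InBox z, ‖a z‖ ^ 2 := by
    rw [← filter_filter, ← filter_filter, sum_filter_add_sum_filter_not]
  have hcases : ∀ z, z ≠ 0 → (q z ↔ ¬ p z) := by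
    intro z hz
    have : ¬ (z.1.valMinAbs = 0 ∧ z.2.valMinAbs = 0) := fun h =>
      hz (Prod.ext ((ZMod.valMinAbs_eq_zero _).1 h.1) ((ZMod.valMinAbs_eq_zero _).1 h.2))
    simp only [hpd, hqd]
    omega
  have hpq : ∀ (r : ZMod m × ZMod m → Prop) [DecidablePred r], ∑ z with r z, ‖a z‖ ^ 2 =
      ∑ z with p z ∧ r z, ‖a z‖ ^ 2 + ∑ z with q z ∧ r z, ‖a z‖ ^ 2 := by
    intro r _
    simp only [sum_filter, ← sum_add_distrib]
    refine sum_congr rfl fun z _ => ?_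
    by_cases hz : z = 0
    · simp [hz, h0]
    · rw [hcases z hz]
      by_cases hp : p z <;> by_cases hr : r z <;> simp [hp, hr]
  have h3 := hpq fun _ => True
  simp only [and_true, filter_true] at h3
  have h4 := hpq fun z => ¬ InBox z
  linarith

/-- The Fourier transform on `(ZMod m)²`. -/
noncomputable def planeDFT {m : ℕ} [NeZero m] (f : ZMod m × ZMod m → ℂ)
    (z : ZMod m × ZMod m) : ℂ :=
  ∑ w, f w * ZMod.stdAddChar (z.1 * w.1 + z.2 * w.2)

theorem planeDFT_sub {m : ℕ} [NeZero m] (f g : ZMod m × ZMod m → ℂ) (z : ZMod m × ZMod m) :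
    planeDFT (fun w => f w - g w) z = planeDFT f z - planeDFT g z := by
  simp only [planeDFT, sub_mul, Finset.sum_sub_distrib]

theorem planeDFT_comp {m : ℕ} [NeZero m] (f : ZMod m × ZMod m → ℂ)
    (T : Equiv.Perm (ZMod m × ZMod m)) (z : ZMod m × ZMod m) :
    planeDFT (fun w => f (T w)) z =
      ∑ w, f w * ZMod.stdAddChar (z.1 * (T.symm w).1 + z.2 * (T.symm w).2) := by
  rw [planeDFT, ← Equiv.sum_comp T.symm]
  simp only [Equiv.apply_symm_apply]

theorem sum_stdAddChar_plane {m : ℕ} [NeZero m] (w : ZMod m × ZMod m) :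
    ∑ z : ZMod m × ZMod m, (ZMod.stdAddChar (z.1 * w.1 + z.2 * w.2) : ℂ) =
      if w = 0 then (m : ℂ) ^ 2 else 0 := by
  simp only [AddChar.map_add_eq_mul]
  rw [Fintype.sum_prod_type]
  simp only [← Finset.mul_sum, ← Finset.sum_mul]
  rw [AddChar.sum_mulShift _ (ZMod.isPrimitive_stdAddChar m),
    AddChar.sum_mulShift _ (ZMod.isPrimitive_stdAddChar m)]
  by_cases h1 : w.1 = 0 <;> by_cases h2 : w.2 = 0 <;> simp [h1, h2, Prod.ext_iff, sq]

theorem sum_sq_norm_planeDFT {m : ℕ} [NeZero m] (f : ZMod m × ZMod m → ℂ) :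
    ∑ z, ‖planeDFT f z‖ ^ 2 = (m : ℝ) ^ 2 * ∑ w, ‖f w‖ ^ 2 := by
  have h : ∀ c : ℂ, ((‖c‖ ^ 2 : ℝ) : ℂ) = c * (starRingEnd ℂ) c := fun c => by
    rw [Complex.mul_conj, Complex.normSq_eq_norm_sq]
  apply Complex.ofReal_injective
  push_cast
  simp only [← Complex.ofReal_pow, h]
  have h1 : ∀ z : ZMod m × ZMod m, planeDFT f z * (starRingEnd ℂ) (planeDFT f z) =
      ∑ w, ∑ u, f w * (starRingEnd ℂ) (f u) *
        ZMod.stdAddChar (z.1 * (w - u).1 + z.2 * (w - u).2) := by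
    intro z
    rw [planeDFT, map_sum, Finset.sum_mul_sum]
    refine Finset.sum_congr rfl fun w _ => Finset.sum_congr rfl fun u _ => ?_
    rw [map_mul, ← AddChar.map_neg_eq_conj]
    have hw : (ZMod.stdAddChar (z.1 * (w - u).1 + z.2 * (w - u).2) : ℂ) =
        ZMod.stdAddChar (z.1 * w.1 + z.2 * w.2) * ZMod.stdAddChar (-(z.1 * u.1 + z.2 * u.2)) := by
      rw [← AddChar.map_add_eq_mul]
      congr 1
      simp only [Prod.fst_sub, Prod.snd_sub]
      ring
    rw [hw]
    ring
  simp only [h1]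
  rw [Finset.sum_comm, Finset.mul_sum]
  refine Finset.sum_congr rfl fun w _ => ?_
  rw [Finset.sum_comm]
  simp only [← Finset.mul_sum, sum_stdAddChar_plane, sub_eq_zero]
  simp
  ring

/-- The angle `θ` of the character value has absolute value between `π / 2` and `π`, and `|1 - exp
(iθ)|² = 2 - 2 cos θ`. -/
theorem two_le_sq_norm_sub_stdAddChar {m : ℕ} [NeZero m] {x : ZMod m}
    (hx : ¬ 4 * |x.valMinAbs| < m) : 2 ≤ ‖1 - (ZMod.stdAddChar x : ℂ)‖ ^ 2 := by
  have hm : (0 : ℝ) < m := by exact_mod_cast NeZero.pos m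
  set θ : ℝ := 2 * Real.pi * x.valMinAbs / m with hθ
  have h1 : (ZMod.stdAddChar x : ℂ) = Complex.exp (θ * Complex.I) := by
    conv_lhs => rw [← ZMod.coe_valMinAbs x, ZMod.stdAddChar_coe]
    congr 1
    rw [hθ]
    push_cast
    ring
  have h2 : Real.cos θ ≤ 0 := by
    rw [← Real.cos_abs]
    have habs : |θ| = 2 * Real.pi * |(x.valMinAbs : ℝ)| / m := by
      rw [hθ, abs_div, abs_mul, abs_of_pos Real.two_pi_pos, abs_of_pos hm]
    have h3 : (m : ℝ) ≤ 4 * |(x.valMinAbs : ℝ)| := by exact_mod_cast not_lt.1 hx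
    have h4 : 2 * |(x.valMinAbs : ℝ)| ≤ m := by
      have := ZMod.valMinAbs_mem_Ioc x
      have : 2 * |x.valMinAbs| ≤ (m : ℤ) := by
        rcases abs_cases x.valMinAbs with h | h <;> linarith [this.1, this.2]
      exact_mod_cast this
    apply Real.cos_nonpos_of_pi_div_two_le_of_le
    · rw [habs, le_div_iff₀ hm]
      nlinarith [Real.pi_pos]
    · rw [habs, div_le_iff₀ hm]
      nlinarith [Real.pi_pos]
  rw [h1, Complex.sq_norm, Complex.normSq_apply]
  simp only [Complex.sub_re, Complex.sub_im, Complex.one_re, Complex.one_im,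
    Complex.exp_ofReal_mul_I_re, Complex.exp_ofReal_mul_I_im]
  nlinarith [Real.sin_sq_add_cos_sq θ]

/-- The generators of the Margulis graph on `(ZMod m)²`: two translations and two shears. -/
def margulisGenerators (m : ℕ) : Fin 4 → Equiv.Perm (ZMod m × ZMod m) :=
  ![(Equiv.subRight 1).prodCongr (Equiv.refl _), (Equiv.refl _).prodCongr (Equiv.subRight 1),
    (shearLeft _).symm, (shearRight _).symm]

-- Mean zero says that the transform vanishes at the origin. By Parseval the shear terms measure how
-- far the transform is from shear invariance, and the translation terms control its mass outside
-- the box, where a character is far from 1.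
open Classical in
theorem margulis_poincare {m : ℕ} [NeZero m] (f : ZMod m × ZMod m → ℝ) (hf : ∑ w, f w = 0) :
    ∑ w, f w ^ 2 ≤ 32 * ∑ i, ∑ w, (f w - f (margulisGenerators m i w)) ^ 2 := by
  set F : ZMod m × ZMod m → ℂ := fun w => f w with hF
  set a := planeDFT F with ha
  have hm : (0 : ℝ) < (m : ℝ) ^ 2 := by
    have : (0 : ℝ) < m := by exact_mod_cast NeZero.pos m
    positivity
  have h0 : a 0 = 0 := by
    simp only [ha, planeDFT, Prod.fst_zero, Prod.snd_zero, zero_mul, add_zero,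
      AddChar.map_zero_eq_one, mul_one, hF]
    exact_mod_cast hf
  have hsq : ∀ g : ZMod m × ZMod m → ℝ, ∑ w, g w ^ 2 = ∑ w, ‖(g w : ℂ)‖ ^ 2 := fun g => by
    simp [Complex.norm_real]
  have hE : ∀ T : Equiv.Perm (ZMod m × ZMod m), (m : ℝ) ^ 2 * ∑ w, (f w - f (T w)) ^ 2 =
      ∑ z, ‖a z - planeDFT (fun w => F (T w)) z‖ ^ 2 := by
    intro T
    rw [hsq, ← sum_sq_norm_planeDFT]
    refine Finset.sum_congr rfl fun z _ => ?_
    rw [ha, ← planeDFT_sub]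
    simp [hF]
  have hL := hE (shearLeft _).symm
  have hR := hE (shearRight _).symm
  have h1 := hE ((Equiv.subRight 1).prodCongr (Equiv.refl _))
  have h2 := hE ((Equiv.refl _).prodCongr (Equiv.subRight 1))
  -- The transform turns a shear into the transpose of its inverse, so the two shears are exchanged.
  have cL : ∀ z, planeDFT (fun w => F ((shearLeft _).symm w)) z = a (shearRight _ z) := by
    intro z
    rw [planeDFT_comp, ha, planeDFT]
    refine Finset.sum_congr rfl fun w _ => ?_
    congr 2
    simp only [shearLeft, shearRight, Equiv.symm_symm, Equiv.coe_fn_mk]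
    ring
  have cR : ∀ z, planeDFT (fun w => F ((shearRight _).symm w)) z = a (shearLeft _ z) := by
    intro z
    rw [planeDFT_comp, ha, planeDFT]
    refine Finset.sum_congr rfl fun w _ => ?_
    congr 2
    simp only [shearLeft, shearRight, Equiv.symm_symm, Equiv.coe_fn_mk]
    ring
  have c1 : ∀ z, a z - planeDFT (fun w => F ((Equiv.subRight 1).prodCongr (Equiv.refl _) w)) z =
      a z * (1 - ZMod.stdAddChar z.1) := by
    intro z
    rw [planeDFT_comp, ha, planeDFT, mul_sub, mul_one, Finset.sum_mul]
    congr 1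
    refine Finset.sum_congr rfl fun w _ => ?_
    rw [mul_assoc, ← AddChar.map_add_eq_mul]
    congr 2
    simp
    ring
  have c2 : ∀ z, a z - planeDFT (fun w => F ((Equiv.refl _).prodCongr (Equiv.subRight 1) w)) z =
      a z * (1 - ZMod.stdAddChar z.2) := by
    intro z
    rw [planeDFT_comp, ha, planeDFT, mul_sub, mul_one, Finset.sum_mul]
    congr 1
    refine Finset.sum_congr rfl fun w _ => ?_
    rw [mul_assoc, ← AddChar.map_add_eq_mul]
    congr 2
    simp
    ring
  simp only [cL] at hL
  simp only [cR] at hR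
  simp only [c1, norm_mul, mul_pow] at h1
  simp only [c2, norm_mul, mul_pow] at h2
  have hbox : 2 * ∑ z with ¬ InBox z, ‖a z‖ ^ 2 ≤
      ∑ z, ‖a z‖ ^ 2 * ‖1 - (ZMod.stdAddChar z.1 : ℂ)‖ ^ 2 +
        ∑ z, ‖a z‖ ^ 2 * ‖1 - (ZMod.stdAddChar z.2 : ℂ)‖ ^ 2 := by
    rw [← Finset.sum_add_distrib, Finset.mul_sum]
    refine le_trans (Finset.sum_le_sum fun z hz => ?_) (Finset.sum_le_sum_of_subset_of_nonneg
      (Finset.subset_univ _) fun z _ _ => by positivity)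
    rw [← mul_add, mul_comm]
    refine mul_le_mul_of_nonneg_left ?_ (by positivity)
    rcases not_and_or.1 (Finset.mem_filter.1 hz).2 with h | h
    · exact (two_le_sq_norm_sub_stdAddChar h).trans (le_add_of_nonneg_right (by positivity))
    · exact (two_le_sq_norm_sub_stdAddChar h).trans (le_add_of_nonneg_left (by positivity))
  have hmain := sum_sq_norm_le_of_shears a h0
  have hP := sum_sq_norm_planeDFT F
  rw [← ha, ← hsq f] at hP
  refine le_of_mul_le_mul_left ?_ hm
  have e1 : 0 ≤ ∑ z, ‖a z‖ ^ 2 * ‖1 - (ZMod.stdAddChar z.1 : ℂ)‖ ^ 2 :=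
    Finset.sum_nonneg fun z _ => by positivity
  have e2 : 0 ≤ ∑ z, ‖a z‖ ^ 2 * ‖1 - (ZMod.stdAddChar z.2 : ℂ)‖ ^ 2 :=
    Finset.sum_nonneg fun z _ => by positivity
  rw [Fin.sum_univ_four]
  simp only [margulisGenerators, Matrix.cons_val]
  rw [mul_left_comm]
  simp only [mul_add, h1, h2, hL, hR]
  linarith

/-! ### From a Poincaré inequality to edge expansion -/

/-- The graph that joins each vertex to its images under a family of permutations. -/
def permGraph {V ι : Type} (g : ι → Equiv.Perm V) : SimpleGraph V :=
  SimpleGraph.fromRel fun u v => ∃ i, g i u = v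

theorem degreeAtMost_permGraph {V ι : Type} [Fintype V] [Fintype ι] (g : ι → Equiv.Perm V) :
    DegreeAtMost (permGraph g) (2 * Fintype.card ι) := by
  classical
  intro v
  rw [← SimpleGraph.card_neighborFinset_eq_degree]
  refine (Finset.card_le_card (t := Finset.univ.image (fun i => g i v) ∪
    Finset.univ.image (fun i => (g i).symm v)) fun u hu => ?_).trans
    ((Finset.card_union_le _ _).trans ?_)
  · rw [SimpleGraph.mem_neighborFinset, permGraph, SimpleGraph.fromRel_adj] at hu
    rcases hu.2 with ⟨i, hi⟩ | ⟨i, hi⟩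
    · exact Finset.mem_union_left _ (Finset.mem_image.2 ⟨i, Finset.mem_univ i, hi⟩)
    · exact Finset.mem_union_right _ (Finset.mem_image.2 ⟨i, Finset.mem_univ i, by simp [← hi]⟩)
  · rw [two_mul]
    exact add_le_add Finset.card_image_le Finset.card_image_le

/-- The inequality is tested on the centred indicator of `S`. Its squared norm is at least `#S / 2`,
and each permutation contributes at most twice the number of crossing edges, once for leaving `S`
and once for entering it. -/
theorem hasExpansion_permGraph {V ι : Type} [Fintype V] [Fintype ι] [Nonempty ι]
    (g : ι → Equiv.Perm V) {C : ℝ} (hC : 0 < C)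
    (h : ∀ f : V → ℝ, ∑ v, f v = 0 → ∑ v, f v ^ 2 ≤ C * ∑ i, ∑ v, (f v - f (g i v)) ^ 2) :
    HasExpansion (permGraph g) (1 / (4 * C * Fintype.card ι)) := by
  classical
  intro S hS
  rcases S.eq_empty_or_nonempty with rfl | hSne
  · simp
  set N := Fintype.card V with hN
  have hN0 : (0 : ℝ) < N := by
    have := Finset.card_pos.2 hSne
    exact_mod_cast (by omega : 0 < N)
  set s : ℝ := (S.card : ℝ) with hs
  have hs2 : 2 * s ≤ N := by rw [hs]; exact_mod_cast hS
  have hs0 : 0 ≤ s := Nat.cast_nonneg _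
  set χ : V → ℝ := fun v => if v ∈ S then 1 else 0 with hχ
  have hχs : ∑ v, χ v = s := by simp [hχ, hs]
  have hχ2 : ∑ v, χ v ^ 2 = s := by simp [hχ, hs]
  have h1 := h (fun v => χ v - s / N) (by
    rw [Finset.sum_sub_distrib, hχs]
    simp only [Finset.sum_const, Finset.card_univ, nsmul_eq_mul]
    field_simp
    ring)
  have h2 : ∑ v, (χ v - s / N) ^ 2 = s - s ^ 2 / N := by
    simp only [sub_sq, Finset.sum_add_distrib, Finset.sum_sub_distrib, hχ2, ← Finset.sum_mul,
      ← Finset.mul_sum, hχs]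
    simp only [Finset.sum_const, Finset.card_univ, nsmul_eq_mul]
    field_simp
    ring
  have h3 : s / 2 ≤ s - s ^ 2 / N := by
    have : s ^ 2 / N ≤ s / 2 := by
      rw [div_le_div_iff₀ hN0 two_pos]
      nlinarith
    linarith
  set D := (permGraph g).interedges S Sᶜ with hD
  have h4 : ∀ i, ∑ v, (χ v - χ (g i v)) ^ 2 ≤ 2 * D.card := by
    intro i
    have e1 : (Finset.univ.filter fun v => v ∈ S ∧ g i v ∉ S).card ≤ D.card := by
      refine Finset.card_le_card_of_injOn (fun v => (v, g i v)) (fun v hv => ?_)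
        fun u _ v _ huv => (Prod.ext_iff.1 huv).1
      simp only [Finset.coe_filter, Finset.mem_univ, true_and, Set.mem_ofPred_eq] at hv
      rw [hD, Finset.mem_coe, SimpleGraph.mk_mem_interedges_iff]
      refine ⟨hv.1, by simpa using hv.2, ?_⟩
      rw [permGraph, SimpleGraph.fromRel_adj]
      exact ⟨fun he => hv.2 (he ▸ hv.1), .inl ⟨i, rfl⟩⟩
    have e2 : (Finset.univ.filter fun v => v ∉ S ∧ g i v ∈ S).card ≤ D.card := by
      refine Finset.card_le_card_of_injOn (fun v => (g i v, v)) (fun v hv => ?_)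
        fun u _ v _ huv => (Prod.ext_iff.1 huv).2
      simp only [Finset.coe_filter, Finset.mem_univ, true_and, Set.mem_ofPred_eq] at hv
      rw [hD, Finset.mem_coe, SimpleGraph.mk_mem_interedges_iff]
      refine ⟨hv.2, by simpa using hv.1, ?_⟩
      rw [permGraph, SimpleGraph.fromRel_adj]
      exact ⟨fun he => hv.1 (he ▸ hv.2), .inr ⟨i, rfl⟩⟩
    have e3 : ∑ v, (χ v - χ (g i v)) ^ 2 =
        ((Finset.univ.filter fun v => v ∈ S ∧ g i v ∉ S).card : ℝ) +
          ((Finset.univ.filter fun v => v ∉ S ∧ g i v ∈ S).card : ℝ) := by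
      rw [Finset.card_filter, Finset.card_filter]
      push_cast
      rw [← Finset.sum_add_distrib]
      refine Finset.sum_congr rfl fun v _ => ?_
      by_cases p1 : v ∈ S <;> by_cases p2 : g i v ∈ S <;> simp [hχ, p1, p2]
    have e1' : ((Finset.univ.filter fun v => v ∈ S ∧ g i v ∉ S).card : ℝ) ≤ D.card := by
      exact_mod_cast e1
    have e2' : ((Finset.univ.filter fun v => v ∉ S ∧ g i v ∈ S).card : ℝ) ≤ D.card := by
      exact_mod_cast e2
    linarith
  have h5 : ∑ i, ∑ v, (χ v - χ (g i v)) ^ 2 ≤ Fintype.card ι * (2 * (D.card : ℝ)) := by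
    refine (Finset.sum_le_sum fun i _ => h4 i).trans ?_
    simp
  simp only [sub_sub_sub_cancel_right] at h1
  rw [h2] at h1
  have hι : (0 : ℝ) < Fintype.card ι := by exact_mod_cast Fintype.card_pos
  have h6 := mul_le_mul_of_nonneg_left h5 hC.le
  rw [div_mul_eq_mul_div, one_mul, div_le_iff₀ (by positivity)]
  convert (by linarith : s ≤ (D.card : ℝ) * (4 * C * Fintype.card ι)) using 3

/-- There are expanders of degree at most `8` with `m ^ 2` vertices. -/
theorem exists_expander (m : ℕ) [NeZero m] : ∃ G : SimpleGraph (Fin (m ^ 2)),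
    DegreeAtMost G 8 ∧ HasExpansion G (1 / 512) := by
  have hcard : Fintype.card (ZMod m × ZMod m) = m ^ 2 := by
    rw [Fintype.card_prod, ZMod.card, sq]
  let e : ZMod m × ZMod m ≃ Fin (m ^ 2) := Fintype.equivFinOfCardEq hcard
  let g : Fin 4 → Equiv.Perm (Fin (m ^ 2)) := fun i => e.permCongr (margulisGenerators m i)
  refine ⟨permGraph g, degreeAtMost_permGraph g, ?_⟩
  have h := hasExpansion_permGraph g (C := 32) (by norm_num) fun f hf => by
    have := margulis_poincare (fun w => f (e w)) (by rw [Equiv.sum_comp e]; exact hf)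
    rw [Equiv.sum_comp e fun v => f v ^ 2] at this
    refine this.trans_eq ?_
    congr 1
    refine Finset.sum_congr rfl fun i _ => ?_
    rw [← Equiv.sum_comp e]
    simp [g, Equiv.permCongr_apply]
  norm_num at h
  norm_num
  exact h

/-! ### Shallow mixtures and their squares -/

namespace Circuit

/-- The shallow mixture `∑ i, w i * ∏ v, φ i v (x v)`: its units are the output `none`, the
components `some (i, none)` and the input units `some (i, some v)`. -/
noncomputable def mixture {V I : Type} [Fintype V] [DecidableEq V] [Nonempty V] [Fintype I]
    [DecidableEq I] [Nonempty I] (w : I → ℝ) (φ : I → V → Bool → ℝ) : Circuit V where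
  U := Option (I × Option V)
  kind
    | none => .sum fun u => u.elim 0 fun p => w p.1
    | some (_, none) => .product
    | some (i, some v) => .input {v} fun y => φ i v (y ⟨v, Finset.mem_singleton_self v⟩)
  inputs
    | none => Finset.univ.image fun i => some (i, none)
    | some (i, none) => Finset.univ.image fun v => some (i, some v)
    | some (_, some _) => ∅
  acyclic := by
    refine Subrelation.wf (r := InvImage (· < ·) fun u : Option (I × Option V) =>
      u.elim 2 fun p => p.2.elim 1 fun _ => 0) ?_ (InvImage.wf _ wellFounded_lt)
    rintro i (_ | ⟨j, _ | v⟩) h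
    · obtain ⟨i, -, rfl⟩ := Finset.mem_image.1 h
      simp [InvImage]
    · obtain ⟨v, -, rfl⟩ := Finset.mem_image.1 h
      simp [InvImage]
    · simp at h
  inputs_eq_empty_iff := by
    rintro (_ | ⟨j, _ | v⟩)
    · simp [Finset.univ_nonempty.ne_empty]
    · simp [Finset.univ_nonempty.ne_empty]
    · simp only [true_iff]
      exact ⟨_, _, rfl⟩
  output := none

variable {V I : Type} [Fintype V] [DecidableEq V] [Nonempty V] [Fintype I]
  [DecidableEq I] [Nonempty I] (w : I → ℝ) (φ : I → V → Bool → ℝ)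

/-- The `i`-th component of a mixture. -/
noncomputable def mixtureComponent (i : I) : (mixture w φ).U :=
  (some (i, none) : Option (I × Option V))

/-- The input unit of the `i`-th component of a mixture for the variable `v`. -/
noncomputable def mixtureInput (i : I) (v : V) : (mixture w φ).U :=
  (some (i, some v) : Option (I × Option V))

theorem mixtureComponent_injective : Function.Injective (mixtureComponent w φ) := fun i j h => by
  have h : (some (i, none) : Option (I × Option V)) = some (j, none) := h
  simpa using h

theorem mixtureInput_injective (i : I) : Function.Injective (mixtureInput w φ i) := fun u v h => by
  have h : (some (i, some u) : Option (I × Option V)) = some (i, some v) := h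
  simpa using h

theorem mixture_kind_output : (mixture w φ).kind (mixture w φ).output =
    .sum fun u : Option (I × Option V) => u.elim 0 fun p => w p.1 := rfl

theorem mixture_kind_component (i : I) :
    (mixture w φ).kind (mixtureComponent w φ i) = .product := rfl

theorem mixture_kind_input (i : I) (v : V) : (mixture w φ).kind (mixtureInput w φ i v) =
    .input {v} fun y => φ i v (y ⟨v, Finset.mem_singleton_self v⟩) := rfl

theorem mixture_inputs_output : (mixture w φ).inputs (mixture w φ).output =
    Finset.univ.image (mixtureComponent w φ) := rfl

theorem mixture_inputs_component (i : I) : (mixture w φ).inputs (mixtureComponent w φ i) =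
    Finset.univ.image (mixtureInput w φ i) := rfl

theorem exists_of_mem_inputs_output {u : (mixture w φ).U}
    (hu : u ∈ (mixture w φ).inputs (mixture w φ).output) : ∃ i, u = mixtureComponent w φ i := by
  rw [mixture_inputs_output] at hu
  obtain ⟨i, -, rfl⟩ := Finset.mem_image.1 hu
  exact ⟨i, rfl⟩

theorem exists_of_mem_inputs_component {i : I} {u : (mixture w φ).U}
    (hu : u ∈ (mixture w φ).inputs (mixtureComponent w φ i)) :
    ∃ v, u = mixtureInput w φ i v := by
  rw [mixture_inputs_component] at hu
  obtain ⟨v, -, rfl⟩ := Finset.mem_image.1 hu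
  exact ⟨v, rfl⟩

theorem mixture_cases {p : (mixture w φ).U → Prop} (u : (mixture w φ).U)
    (h1 : p (mixture w φ).output) (h2 : ∀ i, p (mixtureComponent w φ i))
    (h3 : ∀ i v, p (mixtureInput w φ i v)) : p u :=
  match u with
  | none => h1
  | some (i, none) => h2 i
  | some (i, some v) => h3 i v

theorem mixture_scope_input (i : I) (v : V) :
    (mixture w φ).scope (mixtureInput w φ i v) = {v} :=
  scope_input (mixture_kind_input w φ i v)

theorem mixture_value_input (i : I) (v : V) (x : V → Bool) :
    (mixture w φ).value x (mixtureInput w φ i v) = φ i v (x v) :=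
  value_input (mixture_kind_input w φ i v)

theorem mixture_scope_component (i : I) :
    (mixture w φ).scope (mixtureComponent w φ i) = Finset.univ := by
  rw [scope_product (mixture_kind_component w φ i), mixture_inputs_component, Finset.image_biUnion]
  simp only [mixture_scope_input]
  ext v
  simp

theorem mixture_value_component (i : I) (x : V → Bool) :
    (mixture w φ).value x (mixtureComponent w φ i) = ∏ v, φ i v (x v) := by
  rw [value_product (mixture_kind_component w φ i), mixture_inputs_component,
    Finset.prod_image (mixtureInput_injective w φ i).injOn]
  exact Finset.prod_congr rfl fun v _ => mixture_value_input w φ i v x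

theorem mixture_scope_output : (mixture w φ).scope (mixture w φ).output = Finset.univ := by
  rw [scope_sum (mixture_kind_output w φ), mixture_inputs_output, Finset.image_biUnion]
  simp only [mixture_scope_component]
  ext v
  simp

theorem mixture_value_output (x : V → Bool) :
    (mixture w φ).value x (mixture w φ).output = ∑ i, w i * ∏ v, φ i v (x v) := by
  rw [value_sum (mixture_kind_output w φ), mixture_inputs_output,
    Finset.sum_image (mixtureComponent_injective w φ).injOn]
  refine Finset.sum_congr rfl fun i _ => ?_
  rw [mixture_value_component]
  rfl

theorem mixture_size :
    (mixture w φ).size = Fintype.card I + Fintype.card I * Fintype.card V := by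
  have : (mixture w φ).size = ∑ n : Option (I × Option V), ((mixture w φ).inputs n).card := rfl
  rw [this, Fintype.sum_option, Fintype.sum_prod_type]
  simp only [Fintype.sum_option]
  congr 1
  · exact (Finset.card_image_of_injective _ (mixtureComponent_injective w φ)).trans
      Finset.card_univ
  · rw [← smul_eq_mul, ← Finset.card_univ (α := I), ← Finset.sum_const]
    refine Finset.sum_congr rfl fun i _ => ?_
    refine Eq.trans (congrArg₂ _ ((Finset.card_image_of_injective _
      (mixtureInput_injective w φ i)).trans Finset.card_univ)
      (Finset.sum_eq_zero fun v _ => Finset.card_empty)) (add_zero _)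

theorem mixture_isShallowMixture : (mixture w φ).IsShallowMixture := by
  refine ⟨mixture_scope_output w φ, ⟨_, mixture_kind_output w φ⟩, fun u hu => ?_⟩
  obtain ⟨i, rfl⟩ := exists_of_mem_inputs_output w φ hu
  refine ⟨rfl, fun u hu => ?_⟩
  obtain ⟨v, rfl⟩ := exists_of_mem_inputs_component w φ hu
  exact ⟨{v}, _, mixture_kind_input w φ i v, Finset.card_singleton v⟩

theorem mixture_eq_component_of_product {u : (mixture w φ).U}
    (hu : (mixture w φ).kind u = .product) : ∃ i, u = mixtureComponent w φ i := by
  induction u using mixture_cases with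
  | h1 => cases (mixture_kind_output w φ).symm.trans hu
  | h2 i => exact ⟨i, rfl⟩
  | h3 i v => cases (mixture_kind_input w φ i v).symm.trans hu

theorem mixture_isStructuredDecomposable : (mixture w φ).IsStructuredDecomposable := by
  refine ⟨?_, ?_, ?_⟩
  · intro u w' h i hi j hj
    induction u using mixture_cases with
    | h1 =>
      obtain ⟨i, rfl⟩ := exists_of_mem_inputs_output w φ hi
      obtain ⟨j, rfl⟩ := exists_of_mem_inputs_output w φ hj
      rw [mixture_scope_component, mixture_scope_component]
    | h2 k => cases (mixture_kind_component w φ k).symm.trans h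
    | h3 k v => cases (mixture_kind_input w φ k v).symm.trans h
  · intro u h i hi j hj hij
    obtain ⟨k, rfl⟩ := mixture_eq_component_of_product w φ h
    obtain ⟨i, rfl⟩ := exists_of_mem_inputs_component w φ hi
    obtain ⟨j, rfl⟩ := exists_of_mem_inputs_component w φ hj
    rw [mixture_scope_input, mixture_scope_input, Finset.disjoint_singleton]
    rintro rfl
    exact hij rfl
  · intro u u' h h' _
    obtain ⟨k, rfl⟩ := mixture_eq_component_of_product w φ h
    obtain ⟨l, rfl⟩ := mixture_eq_component_of_product w φ h'
    simp only [partition, mixture_inputs_component, Finset.image_image, Function.comp_def,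
      mixture_scope_input]

/-- The components of a mixture as a type. -/
noncomputable def mixtureComponents :
    I ≃ (mixture w φ).inputs (mixture w φ).output :=
  Equiv.ofBijective (fun i => ⟨mixtureComponent w φ i,
    Finset.mem_image_of_mem _ (Finset.mem_univ i)⟩) <| by
    constructor
    · intro i j h
      exact mixtureComponent_injective w φ (Subtype.ext_iff.1 h)
    · rintro ⟨u, hu⟩
      obtain ⟨i, rfl⟩ := exists_of_mem_inputs_output w φ hu
      exact ⟨i, rfl⟩

theorem mixture_isSquareOf :
    (mixture (fun p : I × I => w p.1 * w p.2) fun p v b => φ p.1 v b * φ p.2 v b).IsSquareOf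
      (mixture w φ) := by
  refine ⟨_, _, mixture_kind_output _ _, mixture_kind_output _ _,
    ((mixtureComponents w φ).symm.prodCongr
    (mixtureComponents w φ).symm).trans (mixtureComponents _ _), fun i j => ?_⟩
  obtain ⟨i, rfl⟩ := (mixtureComponents w φ).surjective i
  obtain ⟨j, rfl⟩ := (mixtureComponents w φ).surjective j
  simp only [Equiv.trans_apply, Equiv.prodCongr_apply, Prod.map_apply, Equiv.symm_apply_apply]
  refine ⟨rfl, fun x => ?_⟩
  refine (mixture_value_component _ _ (i, j) x).trans ?_
  rw [Finset.prod_mul_distrib]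
  exact congrArg₂ _ (mixture_value_component _ _ i x).symm (mixture_value_component _ _ j x).symm

open Classical in
/-- The unique disjointness function of a graph is computed by the square of a small shallow
mixture. -/
theorem exists_square_udisj (G : SimpleGraph V) :
    ∃ c q : Circuit V, c.IsShallowMixture ∧ c.IsStructuredDecomposable ∧
      q.IsShallowMixture ∧ q.IsStructuredDecomposable ∧ q.IsSquareOf c ∧
      q.Computes (udisj G) ∧
      c.size ≤ (1 + Fintype.card V ^ 2) ^ 2 * (1 + Fintype.card V) ∧
      q.size ≤ (1 + Fintype.card V ^ 2) ^ 2 * (1 + Fintype.card V) := by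
  -- The index `none` is the constant 1, and an edge is its monomial with weight -1. Variables off
  -- the edge get the constant factor 1, which gives all components the same scope.
  let w : Option G.edgeFinset → ℝ := fun i => i.elim 1 fun _ => -1
  let φ : Option G.edgeFinset → V → Bool → ℝ := fun i v b =>
    i.elim 1 fun e => if v ∈ e.1 then (if b then 1 else 0) else 1
  have hI : Fintype.card (Option G.edgeFinset) ≤ 1 + Fintype.card V ^ 2 := by
    rw [Fintype.card_option, Fintype.card_coe, add_comm]
    exact Nat.add_le_add_left (G.card_edgeFinset_le_card_choose_two.trans
      (Nat.choose_le_pow _ _)) 1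
  have hφ : ∀ (e : G.edgeFinset) (x : V → Bool), ∏ v, φ (some e) v (x v) =
      (e.1.map fun v => if x v then (1 : ℝ) else 0).mul := by
    rintro ⟨e, he⟩ x
    induction e using Sym2.ind with
    | _ u v =>
    have huv : u ≠ v := by
      have : G.Adj u v := by simpa using he
      exact this.ne
    simp only [φ, Option.elim_some, Sym2.mem_iff, Sym2.map_mk, Sym2.mul_mk]
    rw [← Finset.prod_subset (Finset.subset_univ {u, v}), Finset.prod_pair huv]
    · simp
    · intro z _ hz
      simp only [Finset.mem_insert, Finset.mem_singleton] at hz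
      rw [if_neg hz]
  refine ⟨mixture w φ, mixture _ _, mixture_isShallowMixture _ _,
    mixture_isStructuredDecomposable _ _, mixture_isShallowMixture _ _,
    mixture_isStructuredDecomposable _ _, mixture_isSquareOf w φ,
    ⟨mixture_scope_output _ _, fun x => ?_⟩, ?_, ?_⟩
  · rw [mixture_value_output]
    have h : ∑ i, w i * ∏ v, φ i v (x v) =
        1 - ∑ e ∈ G.edgeFinset, (e.map fun v => if x v then (1 : ℝ) else 0).mul := by
      rw [Fintype.sum_option, ← Finset.sum_coe_sort G.edgeFinset, sub_eq_add_neg,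
        ← Finset.sum_neg_distrib]
      congr 1
      · simp [w, φ]
      · refine Finset.sum_congr rfl fun e _ => ?_
        rw [hφ]
        simp [w]
    rw [udisj, ← h, sq, Finset.sum_mul_sum, ← Finset.sum_product', Finset.univ_product_univ]
    refine Finset.sum_congr rfl fun p _ => ?_
    rw [Finset.prod_mul_distrib]
    ring
  · rw [mixture_size, ← mul_one_add]
    refine Nat.mul_le_mul_right _ (hI.trans ?_)
    exact Nat.le_self_pow two_ne_zero _
  · rw [mixture_size, ← mul_one_add, Fintype.card_prod, sq]
    exact Nat.mul_le_mul_right _ (Nat.mul_le_mul hI hI)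

end Circuit

/-! ### The separation -/

theorem theorem1 :
    ∃ (N : ℕ → ℕ) (G : (n : ℕ) → SimpleGraph (Fin (N n))) (d : ℕ) (ε : ℝ),
      0 < ε ∧
      (∀ n, n ≤ N n ∧ 2 ≤ N n ∧ DegreeAtMost (G n) d ∧ HasExpansion (G n) ε) ∧
      (∀ n x, 0 ≤ udisj (G n) x) ∧
      (∃ p : Polynomial ℕ, ∀ n, ∃ c q : Circuit (Fin (N n)),
        c.IsShallowMixture ∧ c.IsStructuredDecomposable ∧
        q.IsShallowMixture ∧ q.IsStructuredDecomposable ∧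
        q.IsSquareOf c ∧ q.Computes (udisj (G n)) ∧
        c.size ≤ p.eval (N n) ∧ q.size ≤ p.eval (N n)) ∧
      (∃ α : ℝ, 0 < α ∧ ∀ n, ∀ c : Circuit (Fin (N n)),
        c.IsStructuredDecomposable → c.IsMonotonic →
        (∀ u Y f, c.kind u = .input Y f → 3 * Y.card ≤ 2 * N n) →
        c.Computes (udisj (G n)) →
        (2 : ℝ) ^ (α * (N n : ℝ)) ≤ (c.size : ℝ)) := by
  choose G hd hG using fun n : ℕ => exists_expander (n + 2)
  have hN : ∀ n : ℕ, n + 2 ≤ (n + 2) ^ 2 := fun n => Nat.le_self_pow two_ne_zero _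
  -- The shift by 2 makes the modulus non-zero and the graph large enough. The exponent is `ε / (24
  -- * (d + 1) * d)` for `d = 8` and `ε = 1 / 512`.
  refine ⟨fun n => (n + 2) ^ 2, G, 8, 1 / 512, by norm_num, fun n => ⟨?_, ?_, hd n, hG n⟩,
    fun n x => sq_nonneg _, ⟨(1 + Polynomial.X ^ 2) ^ 2 * (1 + Polynomial.X), fun n => ?_⟩,
    1 / 512 / (24 * ((8 : ℕ) + 1) * (8 : ℕ)), by positivity, fun n c hc hm hin hF => ?_⟩
  · exact (Nat.le_add_right n 2).trans (hN n)
  · exact (Nat.le_add_left 2 n).trans (hN n)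
  · have := Circuit.exists_square_udisj (G n)
    simpa using this
  · have := c.two_rpow_le_size (by norm_num) (hd n) (by norm_num) (hG n) (by simp) hc hm
      (by simpa using hin) hF
    simpa using this
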